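/- Throughout, graphs are finite, simple and undirected. A cluster graph is a disjoint union of complete graphs. A hitting set of a graph $G$ is a set $X \subseteq V(G)$ such that $G - X$ is a cluster graph (equivalently, $X$ meets every vertex set that induces a path on three vertices). For a cost function $c : V(G) \to \mathbb{R}_{\geqslant 0}$, let $\mathrm{OPT}(G,c)$ be the minimum of $c(X) = \sum_{v \in X} c(v)$ over all hitting sets $X$ of $G$. Let $$P(G) := \{ x \in [0,1]^{V(G)} \mid x_u + x_v + x_w \geqslant 1 \text{ for all } \{u,v,w\} \subseteq V(G) \text{ inducing a path on three vertices}\},$$ described by the inequalities $x_v \geqslant 0$, $x_v \leqslant 1$ and $x_u+x_v+x_w \geqslant 1$. For an integer $r \geqslant 0$, let $\mathrm{SA}_r(G) \subseteq \mathbb{R}^{V(G)}$ be the relaxation obtained from $P(G)$ by $r$ rounds of the Sherali–Adams hierarchy: multiply each of these inequalities by $\prod_{i \in I} x_i \prod_{j \in J} (1-x_j)$, for all disjoint $I, J \subseteq V(G)$ with $|I|+|J| \leqslant r$; linearize the result by setting $x_i^2 := x_i$ and replacing each product $\prod_{i \in I} x_i$ with $|I| \geqslant 2$ by a new variable $x_I$;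 and project the solution set of the resulting linear system onto the variables $x_v$, $v \in V(G)$. Let $\mathrm{SA}_r(G,c) := \min\{\sum_{v} c(v) x_v \mid x \in \mathrm{SA}_r(G)\}$. **Theorem.** There is a polynomial $p$ with real coefficients such that for every real $\varepsilon > 0$ there is an integer $r \geqslant 0$ with $r \leqslant p(1/\varepsilon)$ for which $\mathrm{SA}_r$ is an LP relaxation of the cluster vertex deletion problem with integrality gap at most $2+\varepsilon$. That is, for every graph $G$, the characteristic vector of every hitting set of $G$ belongs to $\mathrm{SA}_r(G)$, and $$\mathrm{OPT}(G,c) \leqslant (2+\varepsilon)\cdot \mathrm{SA}_r(G,c) \quad \text{for every cost function } c : V(G) \to \mathbb{R}_{\geqslant 0}.$$ -/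

import Mathlib

open scoped BigOperators

noncomputable section

/-! ## Cluster vertex deletion -/

/-- A cluster graph is a disjoint union of complete graphs: any two distinct vertices in the
same connected component are adjacent. -/
def IsClusterGraph {V : Type*} (G : SimpleGraph V) : Prop :=
  ∀ u v : V, G.Reachable u v → u ≠ v → G.Adj u v

/-- `X` is a hitting set of `G` if `G - X` is a cluster graph. -/
def IsHittingSet {V : Type*} (G : SimpleGraph V) (X : Finset V) : Prop :=
  IsClusterGraph (G.induce ((X : Set V)ᶜ))

/-- The cost `c(X) = ∑ v ∈ X, c v` of a set of vertices. -/
def setCost {V : Type*} (c : V → ℝ) (X : Finset V) : ℝ :=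
  ∑ v ∈ X, c v

/-- `OPT(G, c)`: the minimum cost of a hitting set of `G`. There are finitely many candidates,
and the whole vertex set is one of them, so the infimum is a minimum. -/
def clusterOPT {V : Type*} [Fintype V] (G : SimpleGraph V) (c : V → ℝ) : ℝ :=
  sInf {t : ℝ | ∃ X : Finset V, IsHittingSet G X ∧ t = setCost c X}

/-! ## The Sherali-Adams hierarchy -/

/-- A system of linear inequalities on `ℝ^V`. The pair `(a, b)` stands for `∑ v, a v * x v ≥ b`. -/
abbrev LinearSystem (V : Type*) := Set ((V → ℝ) × ℝ)

/-- The polyhedron `{x | A x ≥ b}` of solutions of a system. -/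
def LinearSystem.solutions {V : Type*} [Fintype V] (S : LinearSystem V) : Set (V → ℝ) :=
  {x | ∀ q ∈ S, q.2 ≤ ∑ v, q.1 v * x v}

/-- The polynomial `(∑ v, a v * X v - b) * ∏ i ∈ I, X i * ∏ j ∈ J, (1 - X j)`: the constraint
`(a, b)`, written as `∑ v, a v * x v - b ≥ 0`, after multiplication by the product. -/
def multipliedConstraint {V : Type*} [Fintype V] (q : (V → ℝ) × ℝ) (I J : Finset V) :
    MvPolynomial V ℝ :=
  (∑ v, MvPolynomial.C (q.1 v) * MvPolynomial.X v - MvPolynomial.C q.2) *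
    (∏ i ∈ I, MvPolynomial.X i) * ∏ j ∈ J, (1 - MvPolynomial.X j)

/-- The linearization: substitute `x_i ^ 2 := x_i`, and then the variable `y I` for the product
`∏ i ∈ I, x_i`. It is the linear map that sends a monomial to `y` of the set of the variables
that occur in it. -/
def linearize {V : Type*} (y : Finset V → ℝ) : MvPolynomial V ℝ →ₗ[ℝ] ℝ :=
  (MvPolynomial.basisMonomials V ℝ).constr ℝ fun m => y m.support

/-- `y` solves the linear system `L_r`: the empty product is `1`, and every constraint of `S`,
multiplied by `∏ i ∈ I, x_i * ∏ j ∈ J, (1 - x_j)` with `I`, `J` disjoint and `|I| + |J| ≤ r` and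
then linearized, holds. The case `I = J = ∅` keeps the constraints of `S` themselves, so zero
rounds give back `S`. -/
def IsSheraliAdamsSolution {V : Type*} [Fintype V] (S : LinearSystem V) (r : ℕ)
    (y : Finset V → ℝ) : Prop :=
  y ∅ = 1 ∧ ∀ q ∈ S, ∀ I J : Finset V, Disjoint I J → I.card + J.card ≤ r →
    0 ≤ linearize y (multipliedConstraint q I J)

/-- The relaxation after `r` rounds of Sherali-Adams: the projection of the solutions of `L_r` to
the variables `x_v = y {v}`. -/
def sheraliAdams {V : Type*} [Fintype V] (S : LinearSystem V) (r : ℕ) : Set (V → ℝ) :=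
  {x | ∃ y : Finset V → ℝ, IsSheraliAdamsSolution S r y ∧ ∀ v, x v = y {v}}

/-! ## The LP relaxation of cluster vertex deletion -/

/-- The collection of all vertex sets `{u, v, w}` that induce a path on three vertices
(here with middle vertex `v`). -/
def inducedP3s {V : Type*} (G : SimpleGraph V) : Set (Set V) :=
  {s | ∃ u v w : V, s = {u, v, w} ∧ G.Adj u v ∧ G.Adj v w ∧ u ≠ w ∧ ¬ G.Adj u w}

open Classical in
/-- The system that defines `P(G)`: `x_v ≥ 0` and `-x_v ≥ -1` for all vertices `v`, and
`x_u + x_v + x_w ≥ 1` for all induced paths `{u, v, w}` on three vertices. -/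
def p3System {V : Type*} (G : SimpleGraph V) : LinearSystem V :=
  {q | (∃ v, q = (Pi.single v 1, 0)) ∨ (∃ v, q = (-Pi.single v 1, -1)) ∨
    ∃ s ∈ inducedP3s G, q = (s.indicator 1, 1)}

/-- `SA_r(G)`. -/
def clusterSA {V : Type*} [Fintype V] (r : ℕ) (G : SimpleGraph V) : Set (V → ℝ) :=
  sheraliAdams (p3System G) r

/-- `SA_r(G, c)`: the optimum value of minimizing `∑ v, c v * x v` over `SA_r(G)`. -/
def clusterSAValue {V : Type*} [Fintype V] (r : ℕ) (G : SimpleGraph V) (c : V → ℝ) : ℝ :=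
  sInf {t : ℝ | ∃ x ∈ clusterSA r G, t = ∑ v, c v * x v}

end

/-! The proof is a local ratio argument whose weights are controlled by the LP. After `r` rounds of
Sherali–Adams, on each vertex set `H` of size at most `r` the point `x` is a convex combination of
characteristic vectors of hitting sets of `G[H]`, so it satisfies every inequality valid for those
(`locallyFeasible_of_mem_clusterSA`).

Rounding (`exists_hitting_le`) removes one vertex at a time. A vertex of cost zero or with `(2 + ε)
* x v ≥ 1` is taken. Of two adjacent twins, the one with the larger value of `x` is deleted and its
cost is moved to the other. What remains is a twin-free graph with `(2 + ε) * x v < 1` everywhere.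
There, a small weighted subgraph whose `P3Free` sets carry at most about half of the weight
contradicts local feasibility (`LocallyFeasible.not_dense`). This excludes induced four-cycles, and
also cliques and induced stars of size above `k ≈ 1/ε`, so that every neighborhood `A` has `O(k ^
3)` vertices (`card_neighbors_le`). It also excludes five-cycles and pairs of nearly unrelated
induced paths inside `A`, so that some clique `Q` of `A` leaves a cluster graph `A \ Q`
(`exists_hitting_clique`).

From `Q` one builds integer weights, positive on the closed neighborhood of `o` and supported on
`O(k ^ 3)` vertices, of which a `P3Free` set gets at most half, up to rounding
(`exists_weights_of_universal`, `exists_weights_blowup`). By local feasibility the total weight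
minus one is at most twice the weight of `x`. An inclusion-minimal hitting set misses a vertex of
the closed neighborhood, so it weighs at most the total minus one, and the local ratio step loses
only a factor two. -/

section Feasibility
-- From Sherali–Adams to local distributions over hitting sets.
open scoped Classical

/-- No three vertices of `S` induce a path. -/
def P3Free {V : Type*} (G : SimpleGraph V) (S : Finset V) : Prop :=
  ∀ u ∈ S, ∀ v ∈ S, ∀ w ∈ S, G.Adj u v → G.Adj v w → u ≠ w → G.Adj u w

theorem P3Free.mono {V : Type*} {G : SimpleGraph V} {S T : Finset V} (h : P3Free G T)
    (hST : S ⊆ T) : P3Free G S :=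
  fun u hu v hv w hw => h u (hST hu) v (hST hv) w (hST hw)

theorem isHittingSet_iff {V : Type*} [Fintype V] (G : SimpleGraph V) (X : Finset V) :
    IsHittingSet G X ↔ P3Free G (Finset.univ \ X) := by
  constructor
  · intro h u hu v hv w hw huv hvw huw
    simp only [Finset.mem_sdiff, Finset.mem_univ, true_and] at hu hv hw
    let u' : ((X : Set V)ᶜ : Set V) := ⟨u, by simpa using hu⟩
    let v' : ((X : Set V)ᶜ : Set V) := ⟨v, by simpa using hv⟩
    let w' : ((X : Set V)ᶜ : Set V) := ⟨w, by simpa using hw⟩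
    have h1 : (G.induce ((X : Set V)ᶜ)).Adj u' v' := huv
    have h2 : (G.induce ((X : Set V)ᶜ)).Adj v' w' := hvw
    exact h u' w' (h1.reachable.trans h2.reachable) (fun e => huw (congrArg Subtype.val e))
  · intro h u v huv
    obtain ⟨p⟩ := huv
    induction p with
    | nil => intro h; exact absurd rfl h
    | @cons a b c hab p ih =>
      intro hac
      by_cases hbc : b = c
      · subst hbc; exact hab
      · have hbc' := ih hbc
        have mem : ∀ z : ((X : Set V)ᶜ : Set V), z.1 ∈ Finset.univ \ X := fun z => by
          have hz : z.1 ∉ X := z.2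
          simp [hz]
        exact h a.1 (mem a) b.1 (mem b) c.1 (mem c) hab hbc' (fun e => hac (Subtype.ext e))

theorem linearize_monomial {V : Type*} (y : Finset V → ℝ) (m : V →₀ ℕ) (a : ℝ) :
    linearize y (MvPolynomial.monomial m a) = a * y m.support := by
  have h : (MvPolynomial.monomial m a : MvPolynomial V ℝ)
      = a • MvPolynomial.basisMonomials V ℝ m := by
    simp [MvPolynomial.smul_monomial]
  rw [h, map_smul, linearize, Module.Basis.constr_basis, smul_eq_mul]

theorem linearize_X_mul_X_mul {V : Type*} (y : Finset V → ℝ) (v : V) (p : MvPolynomial V ℝ) :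
    linearize y (MvPolynomial.X v * (MvPolynomial.X v * p))
      = linearize y (MvPolynomial.X v * p) := by
  induction p using MvPolynomial.induction_on' with
  | monomial m a =>
    simp only [MvPolynomial.X, MvPolynomial.monomial_mul, linearize_monomial, one_mul]
    congr 2
    ext z
    simp only [Finsupp.mem_support_iff, Finsupp.add_apply]
    omega
  | add p q hp hq => simp only [mul_add, map_add, hp, hq]

theorem linearize_X_mul_one_sub_X_mul {V : Type*} (y : Finset V → ℝ) (v : V)
    (p : MvPolynomial V ℝ) :
    linearize y (MvPolynomial.X v * ((1 - MvPolynomial.X v) * p)) = 0 := by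
  rw [sub_mul, one_mul, mul_sub, map_sub, linearize_X_mul_X_mul, sub_self]

/-- The product `∏ i ∈ I, X i * ∏ j ∈ J, (1 - X j)`. -/
noncomputable def signProduct {V : Type*} (I J : Finset V) : MvPolynomial V ℝ :=
  (∏ i ∈ I, MvPolynomial.X i) * ∏ j ∈ J, (1 - MvPolynomial.X j)

theorem sum_signProduct {V : Type*} (H : Finset V) :
    ∑ X ∈ H.powerset, signProduct X (H \ X) = 1 := by
  have := Finset.prod_add (fun i : V => (MvPolynomial.X i : MvPolynomial V ℝ))
    (fun i => 1 - MvPolynomial.X i) H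
  simp only [add_sub_cancel, Finset.prod_const_one] at this
  exact this.symm

/-- Under linearization `signProduct I J` acts as the indicator of the event "all of `I` and none of
`J`", on which `X v` is constant for `v ∈ I ∪ J`. -/
theorem linearize_X_mul_signProduct {V : Type*} (y : Finset V → ℝ) {I J : Finset V} {v : V} :
    (v ∈ I → linearize y (MvPolynomial.X v * signProduct I J) = linearize y (signProduct I J)) ∧
    (v ∈ J → linearize y (MvPolynomial.X v * signProduct I J) = 0) := by
  constructor
  · intro hv
    have : signProduct I J = MvPolynomial.X v * signProduct (I.erase v) J := by
      rw [signProduct, signProduct, ← Finset.mul_prod_erase I _ hv, mul_assoc]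
    rw [this, linearize_X_mul_X_mul]
  · intro hv
    have : signProduct I J = (1 - MvPolynomial.X v) * signProduct I (J.erase v) := by
      rw [signProduct, signProduct, ← Finset.mul_prod_erase J _ hv]; ring
    rw [this, linearize_X_mul_one_sub_X_mul]

theorem linearize_multipliedConstraint {V : Type*} [Fintype V] (y : Finset V → ℝ)
    (q : (V → ℝ) × ℝ) (I J : Finset V) :
    linearize y (multipliedConstraint q I J)
      = ∑ v, q.1 v * linearize y (MvPolynomial.X v * signProduct I J)
        - q.2 * linearize y (signProduct I J) := by
  have : multipliedConstraint q I J
      = ∑ v, q.1 v • (MvPolynomial.X v * signProduct I J) - q.2 • signProduct I J := by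
    rw [multipliedConstraint, mul_assoc, ← signProduct, sub_mul, Finset.sum_mul]
    simp only [MvPolynomial.smul_eq_C_mul, mul_assoc]
  rw [this, map_sub, map_sum]
  simp only [map_smul, smul_eq_mul]

/-- On each vertex set of size at most `r` the point `x` satisfies all inequalities that hold for
the characteristic vectors of hitting sets (expressed with the set of remaining vertices). -/
def LocallyFeasible {V : Type*} (G : SimpleGraph V) (r : ℕ) (x : V → ℝ) : Prop :=
  ∀ H : Finset V, H.card ≤ r → ∀ (c : V → ℝ) (L : ℝ),
    (∀ S ⊆ H, P3Free G S → ∑ v ∈ S, c v ≤ L) → ∑ v ∈ H, c v * (1 - x v) ≤ L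

theorem sum_three {V : Type*} [Fintype V] {u v w : V} (f : V → ℝ) (huv : u ≠ v) (hvw : v ≠ w)
    (huw : u ≠ w) :
    ∑ z, (({u, v, w} : Set V).indicator 1 z : ℝ) * f z = f u + f v + f w := by
  have : ∀ z, (({u, v, w} : Set V).indicator 1 z : ℝ) * f z
      = if z ∈ ({u, v, w} : Finset V) then f z else 0 := by
    intro z
    by_cases hz : z ∈ ({u, v, w} : Finset V)
    · have hz' : z ∈ ({u, v, w} : Set V) := by simpa using hz
      rw [if_pos hz, Set.indicator_of_mem hz', Pi.one_apply, one_mul]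
    · have hz' : z ∉ ({u, v, w} : Set V) := by simpa using hz
      rw [if_neg hz, Set.indicator_of_notMem hz', zero_mul]
  simp only [this]
  rw [Finset.sum_ite_mem, Finset.univ_inter, Finset.sum_insert (by simp [huv, huw]),
    Finset.sum_insert (by simp [hvw]), Finset.sum_singleton]
  ring

/-- The numbers `μ X` form a probability distribution on the subsets of `H`, supported on hitting
sets of `G[H]`, with marginals `x`. Averaging the inequality over it gives the claim. -/
theorem locallyFeasible_of_mem_clusterSA {V : Type*} [Fintype V] {G : SimpleGraph V} {r : ℕ}
    {x : V → ℝ} (hx : x ∈ clusterSA r G) : LocallyFeasible G r x := by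
  obtain ⟨y, ⟨hy0, hy⟩, hxy⟩ := hx
  intro H hH c L hL
  set μ : Finset V → ℝ := fun X => linearize y (signProduct X (H \ X)) with hμ
  have hcard : ∀ X ∈ H.powerset, X.card + (H \ X).card ≤ r := fun X hX => by
    rw [add_comm, Finset.card_sdiff_add_card_eq_card (Finset.mem_powerset.1 hX)]; exact hH
  have hone : linearize y 1 = 1 := by
    have := linearize_monomial y 0 1
    simpa [hy0] using this
  have hsum : ∑ X ∈ H.powerset, μ X = 1 := by
    rw [hμ, ← map_sum, sum_signProduct, hone]
  have hX : ∀ v, linearize y (MvPolynomial.X v) = x v := fun v => by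
    rw [MvPolynomial.X, linearize_monomial, hxy, one_mul]
    congr 1
    exact Finsupp.support_single v one_ne_zero
  have hmarg : ∀ v ∈ H, x v = ∑ X ∈ H.powerset, if v ∈ X then μ X else 0 := by
    intro v hv
    rw [← hX, ← mul_one (MvPolynomial.X v), ← sum_signProduct H, Finset.mul_sum, map_sum]
    refine Finset.sum_congr rfl fun X _ => ?_
    split_ifs with h
    · exact (linearize_X_mul_signProduct y).1 h
    · exact (linearize_X_mul_signProduct y).2 (by simp [hv, h])
  have hnonneg : ∀ X ∈ H.powerset, 0 ≤ μ X := by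
    intro X hXH
    rcases H.eq_empty_or_nonempty with rfl | ⟨v, hv⟩
    · have : X = ∅ := by simpa using hXH
      subst this
      simp [hμ, signProduct, hone]
    -- The lifted bounds `x_v ≥ 0` and `1 - x_v ≥ 0` add up to `μ X ≥ 0`. This needs some vertex,
    -- hence the separate case of empty `H`.
    · have h1 := hy (Pi.single v 1, 0) (Or.inl ⟨v, rfl⟩) X (H \ X) Finset.disjoint_sdiff
        (hcard X hXH)
      have h2 := hy (-Pi.single v 1, -1) (Or.inr (Or.inl ⟨v, rfl⟩)) X (H \ X)
        Finset.disjoint_sdiff (hcard X hXH)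
      rw [linearize_multipliedConstraint] at h1 h2
      simp [Pi.single_apply] at h1 h2
      simp only [hμ]
      linarith
  have hsupp : ∀ X ∈ H.powerset, ¬ P3Free G (H \ X) → μ X = 0 := by
    intro X hXH hP
    refine le_antisymm ?_ (hnonneg X hXH)
    simp only [P3Free, not_forall] at hP
    obtain ⟨u, hu, v, hv, w, hw, huv, hvw, huw, hn⟩ := hP
    -- All three variables of this constraint occur negated in the product, so only `-μ X ≥ 0`
    -- survives.
    have h := hy (({u, v, w} : Set V).indicator 1, 1)
      (Or.inr (Or.inr ⟨{u, v, w}, ⟨u, v, w, rfl, huv, hvw, huw, hn⟩, rfl⟩)) X (H \ X)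
      Finset.disjoint_sdiff (hcard X hXH)
    rw [linearize_multipliedConstraint] at h
    simp only [] at h
    rw [sum_three _ huv.ne hvw.ne huw, (linearize_X_mul_signProduct y).2 hu,
      (linearize_X_mul_signProduct y).2 hv, (linearize_X_mul_signProduct y).2 hw] at h
    simp only [hμ]
    linarith
  have key : ∑ v ∈ H, c v * (1 - x v) = ∑ X ∈ H.powerset, μ X * ∑ v ∈ H \ X, c v := by
    have : ∀ v ∈ H, c v * (1 - x v) = ∑ X ∈ H.powerset, if v ∈ H \ X then μ X * c v else 0 := by
      intro v hv
      rw [hmarg v hv, ← hsum, ← Finset.sum_sub_distrib, Finset.mul_sum]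
      refine Finset.sum_congr rfl fun X _ => ?_
      by_cases h : v ∈ X <;> simp [h, hv, mul_comm]
    rw [Finset.sum_congr rfl this, Finset.sum_comm]
    refine Finset.sum_congr rfl fun X _ => ?_
    rw [Finset.sum_ite_mem, Finset.inter_eq_right.2 Finset.sdiff_subset, Finset.mul_sum]
  rw [key, ← mul_one L, ← hsum, Finset.mul_sum]
  refine Finset.sum_le_sum fun X hXH => ?_
  by_cases hP : P3Free G (H \ X)
  · rw [mul_comm]
    exact mul_le_mul_of_nonneg_right (hL _ Finset.sdiff_subset hP) (hnonneg X hXH)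
  · rw [hsupp X hXH hP]; simp

theorem indicator_mem_clusterSA {V : Type*} [Fintype V] {G : SimpleGraph V} (r : ℕ)
    {X : Finset V} (hX : IsHittingSet G X) : (X : Set V).indicator 1 ∈ clusterSA r G := by
  set e : V → ℝ := (X : Set V).indicator 1 with he
  have he' : ∀ v, e v = if v ∈ X then 1 else 0 := fun v => by
    simp [he, Set.indicator_apply]
  refine ⟨fun I => if I ⊆ X then 1 else 0, ⟨by simp, ?_⟩, fun v => by simp [he']⟩
  set y : Finset V → ℝ := fun I => if I ⊆ X then 1 else 0 with hy
  -- At a 0/1 point powers of a variable agree with the variable, so linearization is evaluation.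
  have hlin : ∀ p, linearize y p = MvPolynomial.eval e p := by
    intro p
    induction p using MvPolynomial.induction_on' with
    | monomial m a =>
      rw [linearize_monomial, MvPolynomial.eval_monomial, Finsupp.prod]
      congr 1
      simp only [hy]
      split_ifs with h
      · exact (Finset.prod_eq_one fun v hv => by rw [he', if_pos (h hv), one_pow]).symm
      · obtain ⟨v, hv, hvX⟩ := Finset.not_subset.1 h
        refine (Finset.prod_eq_zero hv ?_).symm
        rw [he', if_neg hvX, zero_pow (by simpa using hv)]
    | add p q hp hq => rw [map_add, map_add, hp, hq]
  have h01 : ∀ v, 0 ≤ e v ∧ e v ≤ 1 := fun v => by rw [he']; split_ifs <;> norm_num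
  intro q hq I J _ _
  rw [hlin, multipliedConstraint, map_mul, map_mul, map_prod, map_prod]
  refine mul_nonneg (mul_nonneg ?_ (Finset.prod_nonneg fun v _ => ?_))
    (Finset.prod_nonneg fun v _ => ?_)
  · simp only [map_sub, map_sum, map_mul, MvPolynomial.eval_C, MvPolynomial.eval_X]
    rcases hq with ⟨v, rfl⟩ | ⟨v, rfl⟩ | ⟨s, ⟨u, v, w, rfl, huv, hvw, huw, hn⟩, rfl⟩
    · simp [Pi.single_apply, h01]
    · simp [Pi.single_apply, h01]
    · simp only []
      rw [sum_three _ huv.ne hvw.ne huw]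
      by_contra hlt
      have hu := h01 u
      have hv := h01 v
      have hw := h01 w
      have : ∀ z ∈ ({u, v, w} : Finset V), z ∉ X := by
        intro z hz hzX
        have hz1 := he' z
        rw [if_pos hzX] at hz1
        simp only [Finset.mem_insert, Finset.mem_singleton] at hz
        rcases hz with rfl | rfl | rfl <;> linarith
      exact hn ((isHittingSet_iff G X).1 hX u (by simp [this u]) v (by simp [this v]) w
        (by simp [this w]) huv hvw huw)
  · simpa using (h01 v).1
  · simpa using (h01 v).2

end Feasibility

/-! ### Configurations excluded when all values of `x` are small. -/

section Exclusion
open scoped Classical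

/-- `z` is adjacent to some, but not to all vertices of `C`. -/
def Splits {V : Type*} (G : SimpleGraph V) (z : V) (C : Finset V) : Prop :=
  (∃ u ∈ C, G.Adj z u) ∧ ∃ v ∈ C, ¬ G.Adj z v

theorem Splits.mono {V : Type*} {G : SimpleGraph V} {z : V} {C D : Finset V}
    (h : Splits G z C) (hCD : C ⊆ D) : Splits G z D :=
  ⟨let ⟨u, hu, h'⟩ := h.1; ⟨u, hCD hu, h'⟩, let ⟨u, hu, h'⟩ := h.2; ⟨u, hCD hu, h'⟩⟩

/-- Split `C` recursively by neighborhoods of vertices of `Z`, charging one unit to the vertex used.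
The binary tree has `|C|` leaves and `|C| - 1` inner nodes. The leaves in `C'` need at least `|C'| -
1` nodes to be told apart, and the vertices used there split `C'`. -/
theorem exists_separating_weights {V : Type*} (G : SimpleGraph V) (Z : Finset V) (C : Finset V)
    (hC : C.Nonempty) (hZ : ∀ u ∈ C, ∀ v ∈ C, u ≠ v → ∃ z ∈ Z, Splits G z {u, v}) :
    ∃ w : V → ℕ, (∀ z, w z ≠ 0 → z ∈ Z) ∧ ∑ z ∈ Z, w z + 1 = C.card ∧
      ∀ C' ⊆ C, C'.card ≤ 1 + ∑ z ∈ Z with Splits G z C', w z := by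
  induction C using Finset.strongInduction with
  | H C ih =>
    by_cases h1 : C.card ≤ 1
    · refine ⟨fun _ => 0, by simp, ?_, fun C' hC' => ?_⟩
      · have := hC.card_pos
        simp only [Finset.sum_const_zero]; omega
      · have := Finset.card_le_card hC'
        omega
    · obtain ⟨u, hu, v, hv, huv⟩ := Finset.one_lt_card.1 (not_le.1 h1)
      obtain ⟨z, hz, hs⟩ := hZ u hu v hv huv
      have hsub : ({u, v} : Finset V) ⊆ C := by
        intro t ht
        simp only [Finset.mem_insert, Finset.mem_singleton] at ht
        rcases ht with rfl | rfl <;> assumption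
      obtain ⟨⟨a, ha, hza⟩, b, hb, hzb⟩ := hs.mono hsub
      have hadd : ∀ D : Finset V, (D.filter (G.Adj z)).card + (D.filter (¬ G.Adj z ·)).card
          = D.card := fun D => Finset.card_filter_add_card_filter_not _
      obtain ⟨w1, hw1, hs1, hC1⟩ := ih (C.filter (G.Adj z))
        (Finset.filter_ssubset.2 ⟨b, hb, hzb⟩) ⟨a, by simp [ha, hza]⟩
        (fun u hu v hv => hZ u (Finset.mem_filter.1 hu).1 v (Finset.mem_filter.1 hv).1)
      obtain ⟨w0, hw0, hs0, hC0⟩ := ih (C.filter (¬ G.Adj z ·))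
        (Finset.filter_ssubset.2 ⟨a, ha, by simpa using hza⟩) ⟨b, by simp [hb, hzb]⟩
        (fun u hu v hv => hZ u (Finset.mem_filter.1 hu).1 v (Finset.mem_filter.1 hv).1)
      refine ⟨fun t => w1 t + w0 t + if t = z then 1 else 0, ?_, ?_, ?_⟩
      · intro t ht
        by_cases htz : t = z
        · exact htz ▸ hz
        · simp only [htz, if_false, add_zero] at ht
          by_cases h : w1 t = 0
          · exact hw0 t (by omega)
          · exact hw1 t h
      · simp only [Finset.sum_add_distrib, Finset.sum_ite_eq', hz, if_true]
        have := hadd C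
        omega
      · intro C' hC'
        have hc1 := hC1 (C'.filter (G.Adj z)) (Finset.filter_subset_filter _ hC')
        have hc0 := hC0 (C'.filter (¬ G.Adj z ·)) (Finset.filter_subset_filter _ hC')
        have hm1 : ∑ t ∈ Z with Splits G t (C'.filter (G.Adj z)), w1 t
            ≤ ∑ t ∈ Z with Splits G t C', w1 t :=
          Finset.sum_le_sum_of_subset (Finset.monotone_filter_right _ fun t _ h =>
            h.mono (Finset.filter_subset _ _))
        have hm0 : ∑ t ∈ Z with Splits G t (C'.filter (¬ G.Adj z ·)), w0 t
            ≤ ∑ t ∈ Z with Splits G t C', w0 t :=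
          Finset.sum_le_sum_of_subset (Finset.monotone_filter_right _ fun t _ h =>
            h.mono (Finset.filter_subset _ _))
        have := hadd C'
        simp only [Finset.sum_add_distrib]
        by_cases hsp : Splits G z C'
        · have : (1 : ℕ) ≤ ∑ t ∈ Z with Splits G t C', if t = z then 1 else 0 := by
            rw [Finset.sum_ite_eq', if_pos (by simp [hz, hsp])]
          omega
        · rw [Splits, not_and_or] at hsp
          have hz0 : (C'.filter (G.Adj z)).card = 0 ∨ (C'.filter (¬ G.Adj z ·)).card = 0 := by
            simp only [Finset.card_eq_zero, Finset.filter_eq_empty_iff]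
            rcases hsp with hsp | hsp
            · exact Or.inl fun t ht hzt => hsp ⟨t, ht, hzt⟩
            · exact Or.inr fun t ht hzt => hsp ⟨t, ht, hzt⟩
          rcases hz0 with hz0 | hz0 <;> omega

/-- Weights on vertices outside of a clique `C` such that no `P3Free` set contains more than `|C|`
of the total weight `2 * |C| - 1` of the clique and these vertices. -/
theorem exists_clique_gadget {V : Type*} (G : SimpleGraph V) (Z : Finset V) (C : Finset V)
    (hC : C.Nonempty) (hclique : G.IsClique C) (hdisj : Disjoint Z C)
    (hZ : ∀ u ∈ C, ∀ v ∈ C, u ≠ v → ∃ z ∈ Z, Splits G z {u, v}) :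
    ∃ w : V → ℕ, (∀ z, w z ≠ 0 → z ∈ Z) ∧ ∑ z ∈ Z, w z + 1 = C.card ∧
      ∀ S, P3Free G S → ∑ z ∈ S, w z + 1 ≤ C.card ∧
        ((S ∩ C).Nonempty → (S ∩ C).card + ∑ z ∈ S, w z ≤ C.card) := by
  obtain ⟨w, hw, hs, hC'⟩ := exists_separating_weights G Z C hC hZ
  refine ⟨w, hw, hs, fun S hS => ⟨?_, fun _ => ?_⟩⟩
  · have : ∑ z ∈ S, w z ≤ ∑ z ∈ Z, w z :=
      Finset.sum_le_sum_of_ne_zero fun z _ hz => hw z hz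
    omega
  · have h1 := hC' (S ∩ C) Finset.inter_subset_right
    -- A vertex of `S` splitting `S ∩ C` would end an induced path inside `S`, so the splitting
    -- weight is lost.
    have h2 : ∑ z ∈ S, w z ≤ ∑ z ∈ Z with ¬ Splits G z (S ∩ C), w z := by
      refine Finset.sum_le_sum_of_ne_zero fun z hzS hz => ?_
      have hzZ := hw z hz
      have hzC := Finset.disjoint_left.1 hdisj hzZ
      refine Finset.mem_filter.2 ⟨hzZ, ?_⟩
      rintro ⟨⟨u, hu, hzu⟩, v, hv, hzv⟩
      rw [Finset.mem_inter] at hu hv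
      have huv : u ≠ v := fun e => hzv (e ▸ hzu)
      exact hzv (hS z hzS u hu.1 v hv.1 hzu (hclique hu.2 hv.2 huv) fun e => hzC (e ▸ hv.2))
    have h3 := Finset.sum_filter_add_sum_filter_not Z (fun z => Splits G z (S ∩ C)) w
    omega

/-- Small values force `∑ c v * (1 - x v) > W * (1 + ε) / (2 + ε) ≥ L`, while local feasibility
bounds this sum by `L`. -/
theorem LocallyFeasible.not_dense {V : Type*} {G : SimpleGraph V} {r : ℕ} {x : V → ℝ} {ε : ℝ}
    (hx : LocallyFeasible G r x) (hε : 0 < ε) {H : Finset V} (hsmall : ∀ v ∈ H, (2 + ε) * x v < 1)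
    (hH : H.card ≤ r) (c : V → ℕ) (L W : ℕ) (hW : ∑ v ∈ H, c v = W) (hpos : 0 < W)
    (hL : (L : ℝ) * (2 + ε) ≤ (1 + ε) * W)
    (hS : ∀ S ⊆ H, P3Free G S → ∑ v ∈ S, c v ≤ L) : False := by
  have h := hx H hH (fun v => (c v : ℝ)) L fun S hSH hP => by exact_mod_cast hS S hSH hP
  have hlt : ∑ v ∈ H, (c v : ℝ) * (1 + ε) < ∑ v ∈ H, (c v : ℝ) * ((2 + ε) * (1 - x v)) := by
    obtain ⟨v, hv, hcv⟩ := Finset.exists_ne_zero_of_sum_ne_zero (hW ▸ hpos.ne')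
    refine Finset.sum_lt_sum (fun v hv => ?_) ⟨v, hv, ?_⟩
    · have := hsmall v hv
      exact mul_le_mul_of_nonneg_left (by linarith) (Nat.cast_nonneg _)
    · have := hsmall v hv
      exact mul_lt_mul_of_pos_left (by linarith) (Nat.cast_pos.2 (Nat.pos_of_ne_zero hcv))
  have h2 : ∑ v ∈ H, (c v : ℝ) * ((2 + ε) * (1 - x v))
      = (2 + ε) * ∑ v ∈ H, (c v : ℝ) * (1 - x v) := by
    rw [Finset.mul_sum]
    exact Finset.sum_congr rfl fun v _ => by ring
  have h3 : (∑ v ∈ H, (c v : ℝ)) = W := by exact_mod_cast hW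
  rw [← Finset.sum_mul, h2, h3] at hlt
  have := mul_le_mul_of_nonneg_left h (by linarith : (0 : ℝ) ≤ 2 + ε)
  linarith

theorem half_le_of_two_mul_le {ε : ℝ} (hε : 0 < ε) {L W : ℕ} (h : 2 * L ≤ W) :
    (L : ℝ) * (2 + ε) ≤ (1 + ε) * W := by
  have : (2 : ℝ) * L ≤ W := by exact_mod_cast h
  nlinarith [(Nat.cast_nonneg L : (0 : ℝ) ≤ L)]

/-- The indicator of membership, as a natural number. -/
noncomputable def memInd {V : Type*} (S : Finset V) (v : V) : ℕ := if v ∈ S then 1 else 0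

theorem memInd_le_one {V : Type*} (S : Finset V) (v : V) : memInd S v ≤ 1 := by
  unfold memInd; split_ifs <;> omega

theorem sum_subset_eq_sum_memInd {V : Type*} {S H : Finset V} (h : S ⊆ H) (c : V → ℕ) :
    ∑ v ∈ S, c v = ∑ v ∈ H, c v * memInd S v := by
  simp only [memInd, mul_ite, mul_one, mul_zero]
  rw [Finset.sum_ite_mem, Finset.inter_eq_right.2 h]

theorem P3Free.memInd_add_le {V : Type*} {G : SimpleGraph V} {S : Finset V} (hS : P3Free G S)
    {u v w : V} (huv : G.Adj u v) (hvw : G.Adj v w) (huw : u ≠ w) (hn : ¬ G.Adj u w) :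
    memInd S u + memInd S v + memInd S w ≤ 2 := by
  unfold memInd
  split_ifs with h1 h2 h3 <;> try omega
  exact absurd (hS u h1 v h2 w h3 huv hvw huw) hn

/-- Induced cycles on four vertices. -/
def IsC4 {V : Type*} (G : SimpleGraph V) (a b c d : V) : Prop :=
  G.Adj a b ∧ G.Adj b c ∧ G.Adj c d ∧ G.Adj d a ∧ a ≠ c ∧ b ≠ d ∧ ¬ G.Adj a c ∧ ¬ G.Adj b d

theorem not_isC4 {V : Type*} {G : SimpleGraph V} {r : ℕ} {x : V → ℝ} {ε : ℝ}
    (hx : LocallyFeasible G r x) (hε : 0 < ε) {U : Finset V} (hsmall : ∀ v ∈ U, (2 + ε) * x v < 1)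
    (hr : 4 ≤ r) {a b c d : V} (ha : a ∈ U) (hb : b ∈ U) (hc : c ∈ U) (hd : d ∈ U) :
    ¬ IsC4 G a b c d := by
  rintro ⟨hab, hbc, hcd, hda, hac, hbd, nac, nbd⟩
  have hsum : ∀ f : V → ℕ, ∑ v ∈ ({a, b, c, d} : Finset V), f v = f a + f b + f c + f d := by
    intro f
    rw [Finset.sum_insert, Finset.sum_insert, Finset.sum_insert, Finset.sum_singleton]
    · ring
    all_goals simp [hab.ne, hbc.ne, hcd.ne, hda.ne', hac, hbd]
  have hcard : ({a, b, c, d} : Finset V).card = 4 := by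
    rw [Finset.card_eq_sum_ones, hsum]
  refine hx.not_dense (H := {a, b, c, d}) hε (fun v hv => hsmall v ?_) (hcard.trans_le hr)
    (fun _ => 1) 2 4 (hsum _) (by norm_num) (half_le_of_two_mul_le hε (by norm_num)) ?_
  · simp only [Finset.mem_insert, Finset.mem_singleton] at hv
    rcases hv with rfl | rfl | rfl | rfl <;> assumption
  · intro S hSH hS
    rw [sum_subset_eq_sum_memInd hSH, hsum]
    have h1 := hS.memInd_add_le hab hbc hac nac
    have h2 := hS.memInd_add_le hbc hcd hbd nbd
    have h3 := hS.memInd_add_le hcd hda hac.symm fun h => nac h.symm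
    have h4 := hS.memInd_add_le hda hab hbd.symm fun h => nbd h.symm
    omega

/-- Induced cycles on five vertices. -/
def IsC5 {V : Type*} (G : SimpleGraph V) (a b c d e : V) : Prop :=
  G.Adj a b ∧ G.Adj b c ∧ G.Adj c d ∧ G.Adj d e ∧ G.Adj e a ∧
    a ≠ c ∧ b ≠ d ∧ c ≠ e ∧ d ≠ a ∧ e ≠ b ∧
    ¬ G.Adj a c ∧ ¬ G.Adj b d ∧ ¬ G.Adj c e ∧ ¬ G.Adj d a ∧ ¬ G.Adj e b

/-- With the hub `o`, a `P3Free` set has at most two vertices of the rim, and without it at most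
three: half of six either way. -/
theorem not_isC5 {V : Type*} {G : SimpleGraph V} {r : ℕ} {x : V → ℝ} {ε : ℝ}
    (hx : LocallyFeasible G r x) (hε : 0 < ε) {U : Finset V} (hsmall : ∀ v ∈ U, (2 + ε) * x v < 1)
    (hr : 6 ≤ r) {o a b c d e : V} (ho : o ∈ U) (ha : a ∈ U) (hb : b ∈ U) (hc : c ∈ U)
    (hd : d ∈ U) (he : e ∈ U) (oa : G.Adj o a) (ob : G.Adj o b) (oc : G.Adj o c)
    (od : G.Adj o d) (oe : G.Adj o e) :
    ¬ IsC5 G a b c d e := by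
  rintro ⟨hab, hbc, hcd, hde, hea, hac, hbd, hce, hda, heb, nac, nbd, nce, nda, neb⟩
  have hsum : ∀ f : V → ℕ, ∑ v ∈ ({o, a, b, c, d, e} : Finset V), f v
      = f o + f a + f b + f c + f d + f e := by
    intro f
    rw [Finset.sum_insert, Finset.sum_insert, Finset.sum_insert, Finset.sum_insert,
      Finset.sum_insert, Finset.sum_singleton]
    · ring
    all_goals simp [hab.ne, hbc.ne, hcd.ne, hde.ne, hea.ne', hac, hbd, hce, hda.symm, heb.symm,
      oa.ne, ob.ne, oc.ne, od.ne, oe.ne]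
  have hcard : ({o, a, b, c, d, e} : Finset V).card = 6 := by
    rw [Finset.card_eq_sum_ones, hsum]
  refine hx.not_dense (H := {o, a, b, c, d, e}) hε (fun v hv => hsmall v ?_) (hcard.trans_le hr)
    (fun _ => 1) 3 6 (hsum _) (by norm_num) (half_le_of_two_mul_le hε (by norm_num)) ?_
  · simp only [Finset.mem_insert, Finset.mem_singleton] at hv
    rcases hv with rfl | rfl | rfl | rfl | rfl | rfl <;> assumption
  · intro S hSH hS
    rw [sum_subset_eq_sum_memInd hSH, hsum]
    have h1 := hS.memInd_add_le hab hbc hac nac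
    have h2 := hS.memInd_add_le hbc hcd hbd nbd
    have h3 := hS.memInd_add_le hcd hde hce nce
    have h4 := hS.memInd_add_le hde hea hda nda
    have h5 := hS.memInd_add_le hea hab heb neb
    have h6 := hS.memInd_add_le oa.symm oc hac nac
    have h7 := hS.memInd_add_le ob.symm od hbd nbd
    have h8 := hS.memInd_add_le oc.symm oe hce nce
    have h9 := hS.memInd_add_le od.symm oa hda nda
    have h10 := hS.memInd_add_le oe.symm ob heb neb
    have := memInd_le_one S o
    omega

/-- Two vertex disjoint induced paths `a₁ a₂ a₃` and `b₁ b₂ b₃` without edges between them, except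
possibly `a₁ b₃` and `a₃ b₁`. -/
def IsP3Pair {V : Type*} (G : SimpleGraph V) (a₁ a₂ a₃ b₁ b₂ b₃ : V) : Prop :=
  (G.Adj a₁ a₂ ∧ G.Adj a₂ a₃ ∧ a₁ ≠ a₃ ∧ ¬ G.Adj a₁ a₃) ∧
  (G.Adj b₁ b₂ ∧ G.Adj b₂ b₃ ∧ b₁ ≠ b₃ ∧ ¬ G.Adj b₁ b₃) ∧
  (a₁ ≠ b₁ ∧ a₁ ≠ b₂ ∧ a₁ ≠ b₃ ∧ a₂ ≠ b₁ ∧ a₂ ≠ b₂ ∧ a₂ ≠ b₃ ∧ a₃ ≠ b₁ ∧ a₃ ≠ b₂ ∧ a₃ ≠ b₃) ∧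
  ¬ G.Adj a₁ b₁ ∧ ¬ G.Adj a₁ b₂ ∧ ¬ G.Adj a₂ b₁ ∧ ¬ G.Adj a₂ b₂ ∧ ¬ G.Adj a₂ b₃ ∧
  ¬ G.Adj a₃ b₂ ∧ ¬ G.Adj a₃ b₃

/-- Give `o` weight two. With `o`, the rest of a `P3Free` set is a clique, hence has at most two
vertices. Without `o`, each path contributes at most two. -/
theorem not_isP3Pair {V : Type*} {G : SimpleGraph V} {r : ℕ} {x : V → ℝ} {ε : ℝ}
    (hx : LocallyFeasible G r x) (hε : 0 < ε) {U : Finset V} (hsmall : ∀ v ∈ U, (2 + ε) * x v < 1)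
    (hr : 7 ≤ r) {o a₁ a₂ a₃ b₁ b₂ b₃ : V} (ho : o ∈ U) (ha₁ : a₁ ∈ U) (ha₂ : a₂ ∈ U)
    (ha₃ : a₃ ∈ U) (hb₁ : b₁ ∈ U) (hb₂ : b₂ ∈ U) (hb₃ : b₃ ∈ U)
    (oa₁ : G.Adj o a₁) (oa₂ : G.Adj o a₂) (oa₃ : G.Adj o a₃)
    (ob₁ : G.Adj o b₁) (ob₂ : G.Adj o b₂) (ob₃ : G.Adj o b₃) :
    ¬ IsP3Pair G a₁ a₂ a₃ b₁ b₂ b₃ := by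
  rintro ⟨⟨a12, a23, a13, na13⟩, ⟨b12, b23, b13, nb13⟩, ⟨e11, e12, e13, e21, e22, e23, e31, e32,
    e33⟩, n11, n12, n21, n22, n23, n32, n33⟩
  have hsum : ∀ f : V → ℕ, ∑ v ∈ ({o, a₁, a₂, a₃, b₁, b₂, b₃} : Finset V), f v
      = f o + f a₁ + f a₂ + f a₃ + f b₁ + f b₂ + f b₃ := by
    intro f
    rw [Finset.sum_insert, Finset.sum_insert, Finset.sum_insert, Finset.sum_insert,
      Finset.sum_insert, Finset.sum_insert, Finset.sum_singleton]
    · ring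
    all_goals simp [a12.ne, a23.ne, b12.ne, b23.ne, a13, b13, e11, e12, e13, e21, e22, e23, e31,
      e32, e33, oa₁.ne, oa₂.ne, oa₃.ne, ob₁.ne, ob₂.ne, ob₃.ne]
  have hcard : ({o, a₁, a₂, a₃, b₁, b₂, b₃} : Finset V).card = 7 := by
    rw [Finset.card_eq_sum_ones, hsum]
  refine hx.not_dense (H := {o, a₁, a₂, a₃, b₁, b₂, b₃}) hε (fun v hv => hsmall v ?_)
    (hcard.trans_le hr) (fun v => if v = o then 2 else 1) 4 8 ?_ (by norm_num)
    (half_le_of_two_mul_le hε (by norm_num)) ?_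
  · simp only [Finset.mem_insert, Finset.mem_singleton] at hv
    rcases hv with rfl | rfl | rfl | rfl | rfl | rfl | rfl <;> assumption
  · rw [hsum]
    simp [oa₁.ne', oa₂.ne', oa₃.ne', ob₁.ne', ob₂.ne', ob₃.ne']
  · intro S hSH hS
    rw [sum_subset_eq_sum_memInd hSH, hsum]
    simp only [oa₁.ne', oa₂.ne', oa₃.ne', ob₁.ne', ob₂.ne', ob₃.ne', if_true, if_false]
    have h1 := hS.memInd_add_le a12 a23 a13 na13
    have h2 := hS.memInd_add_le b12 b23 b13 nb13
    have h3 := hS.memInd_add_le oa₁.symm oa₃ a13 na13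
    have h4 := hS.memInd_add_le ob₁.symm ob₃ b13 nb13
    have h5 := hS.memInd_add_le oa₁.symm ob₁ e11 n11
    have h6 := hS.memInd_add_le oa₁.symm ob₂ e12 n12
    have h7 := hS.memInd_add_le oa₂.symm ob₁ e21 n21
    have h8 := hS.memInd_add_le oa₂.symm ob₂ e22 n22
    have h9 := hS.memInd_add_le oa₂.symm ob₃ e23 n23
    have h10 := hS.memInd_add_le oa₃.symm ob₂ e32 n32
    have h11 := hS.memInd_add_le oa₃.symm ob₃ e33 n33
    have := memInd_le_one S o
    have := memInd_le_one S a₁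
    have := memInd_le_one S a₂
    have := memInd_le_one S a₃
    have := memInd_le_one S b₁
    have := memInd_le_one S b₂
    have := memInd_le_one S b₃
    omega

/-- Any two adjacent vertices of `U` are split by a third vertex of `U`. -/
def TwinFree {V : Type*} (G : SimpleGraph V) (U : Finset V) : Prop :=
  ∀ u ∈ U, ∀ v ∈ U, G.Adj u v → ∃ z ∈ U, z ≠ u ∧ z ≠ v ∧ Splits G z {u, v}

/-- A clique on `k + 1` vertices with its gadget has weight `2k + 1`, of which a `P3Free` set gets
at most `k + 1`. The density condition then reduces to `1 ≤ ε * k`. -/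
theorem not_clique {V : Type*} {G : SimpleGraph V} {r : ℕ} {x : V → ℝ} {ε : ℝ}
    (hx : LocallyFeasible G r x) (hε : 0 < ε) {U : Finset V} (hsmall : ∀ v ∈ U, (2 + ε) * x v < 1)
    (htwin : TwinFree G U) {k : ℕ} (hk : 1 ≤ ε * k) (hr : 2 * k + 1 ≤ r) {K : Finset V}
    (hKU : K ⊆ U) (hK : G.IsClique K) : K.card ≤ k := by
  by_contra hlt
  obtain ⟨C, hCK, hC⟩ := Finset.exists_subset_card_eq (Nat.succ_le_of_lt (not_le.1 hlt))
  have hCU := hCK.trans hKU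
  have hclique : G.IsClique C := hK.subset (by exact_mod_cast hCK)
  obtain ⟨w, hw, hs, hS⟩ := exists_clique_gadget G (U \ C) C
    (Finset.card_pos.1 (by omega)) hclique Finset.sdiff_disjoint (by
      intro u hu v hv huv
      obtain ⟨z, hz, hzu, hzv, hsp⟩ := htwin u (hCU hu) v (hCU hv) (hclique hu hv huv)
      refine ⟨z, Finset.mem_sdiff.2 ⟨hz, fun hzC => ?_⟩, hsp⟩
      obtain ⟨t, ht, hzt⟩ := hsp.2
      simp only [Finset.mem_insert, Finset.mem_singleton] at ht
      rcases ht with rfl | rfl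
      · exact hzt (hclique hzC hu hzu)
      · exact hzt (hclique hzC hv hzv))
  set Z := (U \ C).filter (w · ≠ 0) with hZ
  have hsZ : ∑ z ∈ Z, w z = ∑ z ∈ U \ C, w z := by rw [hZ, Finset.sum_filter_ne_zero]
  have hdisj : Disjoint C Z :=
    (Finset.sdiff_disjoint (t := U) (s := C)).symm.mono_right (Finset.filter_subset _ _)
  have hZcard : Z.card ≤ k := by
    have : Z.card ≤ ∑ z ∈ Z, w z := by
      rw [Finset.card_eq_sum_ones]
      exact Finset.sum_le_sum fun z hz => Nat.one_le_iff_ne_zero.2 (Finset.mem_filter.1 hz).2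
    omega
  have hwC : ∀ v ∈ C, w v = 0 := fun v hv => by
    by_contra h
    exact (Finset.mem_sdiff.1 (hw v h)).2 hv
  refine hx.not_dense (H := C ∪ Z) hε (fun v hv => hsmall v ?_) ?_
    (fun v => (if v ∈ C then 1 else 0) + w v) (k + 1) (2 * k + 1) ?_ (by omega) ?_ ?_
  · rcases Finset.mem_union.1 hv with h | h
    · exact hCU h
    · exact (Finset.mem_sdiff.1 (Finset.mem_filter.1 h).1).1
  · have := Finset.card_union_le C Z
    omega
  · rw [Finset.sum_add_distrib, Finset.sum_union hdisj (f := w), Finset.sum_eq_zero hwC,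
      Finset.sum_ite_mem, Finset.union_inter_cancel_left, Finset.sum_const, hC]
    simp only [smul_eq_mul]; omega
  · push_cast; nlinarith
  · intro S _ hP
    obtain ⟨h1, h2⟩ := hS S hP
    rw [Finset.sum_add_distrib, Finset.sum_ite_mem, ← Finset.card_eq_sum_ones]
    rcases (S ∩ C).eq_empty_or_nonempty with h | h
    · rw [h, Finset.card_empty]; omega
    · have := h2 h; omega

/-- With weight `k` on the center and one on each of `k + 1` leaves, a `P3Free` set has the center
and at most one leaf, or only leaves: `k + 1` out of `2k + 1`. -/
theorem not_star {V : Type*} {G : SimpleGraph V} {r : ℕ} {x : V → ℝ} {ε : ℝ}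
    (hx : LocallyFeasible G r x) (hε : 0 < ε) {U : Finset V} (hsmall : ∀ v ∈ U, (2 + ε) * x v < 1)
    {k : ℕ} (hk : 1 ≤ ε * k) (hr : 2 * k + 1 ≤ r) {o : V} (ho : o ∈ U) {I : Finset V}
    (hIU : I ⊆ U) (hoI : ∀ v ∈ I, G.Adj o v) (hI : G.IsIndepSet I) : I.card ≤ k := by
  by_contra hlt
  obtain ⟨C, hCI, hC⟩ := Finset.exists_subset_card_eq (Nat.succ_le_of_lt (not_le.1 hlt))
  have hk1 : 1 ≤ k := by
    rcases Nat.eq_zero_or_pos k with rfl | h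
    · norm_num at hk
    · exact h
  have hoC : o ∉ C := fun h => (hoI o (hCI h)).ne rfl
  have hsumC : ∀ S : Finset V, S ⊆ C → ∑ v ∈ S, (if v = o then k else 1) = S.card := by
    intro S hS
    rw [Finset.card_eq_sum_ones]
    exact Finset.sum_congr rfl fun v hv => if_neg fun (e : v = o) => hoC (hS (e ▸ hv))
  refine hx.not_dense (H := insert o C) hε (fun v hv => hsmall v ?_) ?_
    (fun v => if v = o then k else 1) (k + 1) (2 * k + 1) ?_ (by omega) ?_ ?_
  · rcases Finset.mem_insert.1 hv with rfl | h
    · exact ho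
    · exact hIU (hCI h)
  · rw [Finset.card_insert_of_notMem hoC]; omega
  · rw [Finset.sum_insert hoC, hsumC C subset_rfl, hC, if_pos rfl]; omega
  · push_cast; nlinarith
  · intro S hSH hP
    by_cases hoS : o ∈ S
    · have hsub : S.erase o ⊆ C := by
        intro v hv
        exact (Finset.mem_insert.1 (hSH (Finset.mem_of_mem_erase hv))).resolve_left
          (Finset.ne_of_mem_erase hv)
      have h1 : (S.erase o).card ≤ 1 := by
        refine Finset.card_le_one.2 fun u hu v hv => ?_
        by_contra huv
        have hu' := hCI (hsub hu)
        have hv' := hCI (hsub hv)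
        exact hI hu' hv' huv (hP u (Finset.mem_of_mem_erase hu) o hoS v
          (Finset.mem_of_mem_erase hv) (hoI u hu').symm (hoI v hv') huv)
      rw [← Finset.add_sum_erase S _ hoS, hsumC _ hsub, if_pos rfl]
      omega
    · have hsub : S ⊆ C := fun v hv =>
        (Finset.mem_insert.1 (hSH hv)).resolve_left fun e => hoS (e ▸ hv)
      rw [hsumC S hsub]
      exact (Finset.card_le_card hsub).trans hC.le

/-- Take a maximum independent set `I`. Vertices whose only neighbor in `I` is `i` form a clique
with `i`, since two nonadjacent ones could replace `i`. Common neighbors of two members of `I` form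
a clique, since there is no induced four-cycle. These at most `k + k ^ 2` cliques cover `A`. -/
theorem card_neighbors_le {V : Type*} {G : SimpleGraph V} {A : Finset V} {k : ℕ}
    (hclique : ∀ K ⊆ A, G.IsClique K → K.card ≤ k)
    (hindep : ∀ I ⊆ A, G.IsIndepSet I → I.card ≤ k)
    (hC4 : ∀ a ∈ A, ∀ b ∈ A, ∀ c ∈ A, ∀ d ∈ A, ¬ IsC4 G a b c d) :
    A.card ≤ k ^ 3 + k ^ 2 := by
  obtain ⟨I, hI, hmax⟩ := Finset.exists_max_image (A.powerset.filter fun I : Finset V => G.IsIndepSet (I : Set V))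
    Finset.card ⟨∅, by simp⟩
  simp only [Finset.mem_filter, Finset.mem_powerset] at hI hmax
  obtain ⟨hIA, hI⟩ := hI
  have hIk := hindep I hIA hI
  set P : V → Finset V := fun i => A.filter fun a =>
    a = i ∨ (G.Adj a i ∧ ∀ j ∈ I, G.Adj a j → j = i) with hPdef
  set D : V × V → Finset V := fun q => A.filter fun a =>
    q.1 ≠ q.2 ∧ G.Adj a q.1 ∧ G.Adj a q.2 with hDdef
  have hcover : A ⊆ I.biUnion P ∪ (I ×ˢ I).biUnion D := by
    intro a ha
    rw [Finset.mem_union, Finset.mem_biUnion, Finset.mem_biUnion]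
    by_cases haI : a ∈ I
    · exact Or.inl ⟨a, haI, by simp [hPdef, ha]⟩
    have : ∃ i ∈ I, G.Adj a i := by
      by_contra hno
      push Not at hno
      have := hmax (insert a I) ⟨Finset.insert_subset ha hIA, by
        rw [Finset.coe_insert]
        refine hI.insert fun b hb _ => ⟨hno b hb, fun h => hno b hb h.symm⟩⟩
      rw [Finset.card_insert_of_notMem haI] at this
      omega
    obtain ⟨i, hi, hai⟩ := this
    by_cases hu : ∀ j ∈ I, G.Adj a j → j = i
    · exact Or.inl ⟨i, hi, Finset.mem_filter.2 ⟨ha, Or.inr ⟨hai, hu⟩⟩⟩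
    · push Not at hu
      obtain ⟨j, hj, haj, hji⟩ := hu
      exact Or.inr ⟨(i, j), Finset.mem_product.2 ⟨hi, hj⟩,
        Finset.mem_filter.2 ⟨ha, hji.symm, hai, haj⟩⟩
  have hP : ∀ i ∈ I, (P i).card ≤ k := by
    intro i hi
    refine hclique _ (Finset.filter_subset _ _) fun a ha b hb hab => ?_
    simp only [hPdef, Finset.coe_filter, Set.mem_ofPred_eq] at ha hb
    rcases ha with ⟨haA, rfl | ⟨hai, ha⟩⟩
    · rcases hb with ⟨hbA, rfl | ⟨hbi, hb⟩⟩
      · exact absurd rfl hab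
      · exact hbi.symm
    · rcases hb with ⟨hbA, rfl | ⟨hbi, hb⟩⟩
      · exact hai
      · by_contra hn
        have haI : a ∉ I := fun h => hI h hi hai.ne hai
        have hbI : b ∉ I := fun h => hI h hi hbi.ne hbi
        have hind : G.IsIndepSet (insert a (insert b (I.erase i)) : Finset V) := by
          rw [Finset.coe_insert, Finset.coe_insert]
          have hIe : G.IsIndepSet ((I.erase i : Finset V) : Set V) :=
            hI.mono (by exact_mod_cast Finset.erase_subset _ _)
          have hb' : ∀ j ∈ I.erase i, ¬ G.Adj b j := fun j hj h =>
            Finset.ne_of_mem_erase hj (hb j (Finset.mem_of_mem_erase hj) h)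
          have ha' : ∀ j ∈ I.erase i, ¬ G.Adj a j := fun j hj h =>
            Finset.ne_of_mem_erase hj (ha j (Finset.mem_of_mem_erase hj) h)
          refine Set.Pairwise.insert (Set.Pairwise.insert hIe fun j hj _ =>
            ⟨hb' j hj, fun h => hb' j hj h.symm⟩) fun j hj _ => ?_
          rcases hj with rfl | hj
          · exact ⟨hn, fun h => hn h.symm⟩
          · exact ⟨ha' j hj, fun h => ha' j hj h.symm⟩
        have := hmax _ ⟨Finset.insert_subset haA (Finset.insert_subset hbA
          ((Finset.erase_subset _ _).trans hIA)), hind⟩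
        rw [Finset.card_insert_of_notMem (by simp [hab, haI]),
          Finset.card_insert_of_notMem (by simp [hbI]), Finset.card_erase_of_mem hi] at this
        have := Finset.card_pos.2 ⟨i, hi⟩
        omega
  have hD : ∀ q ∈ I ×ˢ I, (D q).card ≤ k := by
    rintro ⟨i, j⟩ hq
    rw [Finset.mem_product] at hq
    refine hclique _ (Finset.filter_subset _ _) fun a ha b hb hab => ?_
    simp only [hDdef, Finset.coe_filter, Set.mem_ofPred_eq] at ha hb
    obtain ⟨haA, hij, hai, haj⟩ := ha
    obtain ⟨hbA, -, hbi, hbj⟩ := hb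
    by_contra hn
    exact hC4 a haA i (hIA hq.1) b hbA j (hIA hq.2)
      ⟨hai, hbi.symm, hbj, haj.symm, hab, hij, hn, hI hq.1 hq.2 hij⟩
  have h1 := Finset.card_biUnion_le_card_mul I P k hP
  have h2 := Finset.card_biUnion_le_card_mul (I ×ˢ I) D k hD
  rw [Finset.card_product] at h2
  have h3 := (Finset.card_le_card hcover).trans (Finset.card_union_le _ _)
  have h4 : I.card * k ≤ k * k := Nat.mul_le_mul_right k hIk
  have h5 : I.card * I.card * k ≤ k * k * k :=
    Nat.mul_le_mul_right k (Nat.mul_le_mul hIk hIk)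
  have e1 : k ^ 3 = k * k * k := by ring
  have e2 : k ^ 2 = k * k := by ring
  omega

end Exclusion

/-! ### A clique whose removal turns a neighborhood into a cluster graph. -/

section HittingClique
open scoped Classical

theorem exists_gap (P : ℕ → Prop) {m i : ℕ} (h0 : P 0) (hm : P m) (him : i ≤ m) (hi : ¬ P i) :
    ∃ a b, a + 2 ≤ b ∧ b ≤ m ∧ P a ∧ P b ∧ ∀ j, a < j → j < b → ¬ P j := by
  have hex : ∃ b, i ≤ b ∧ P b := ⟨m, him, hm⟩
  have ha : P (Nat.findGreatest P i) := Nat.findGreatest_spec (Nat.zero_le i) h0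
  have hb := Nat.find_spec hex
  have hai : Nat.findGreatest P i < i :=
    lt_of_le_of_ne (Nat.findGreatest_le i) fun e => hi (e ▸ ha)
  have hib : i < Nat.find hex := lt_of_le_of_ne hb.1 fun e => hi (e ▸ hb.2)
  refine ⟨Nat.findGreatest P i, Nat.find hex, by omega, Nat.find_min' hex ⟨him, hm⟩, ha, hb.2,
    fun j haj hjb hj => ?_⟩
  by_cases hji : j ≤ i
  · exact Nat.findGreatest_is_greatest haj hji hj
  · exact Nat.find_min hex hjb ⟨by omega, hj⟩

/-- An induced path, as a sequence. -/
structure IsInducedPath {V : Type*} (G : SimpleGraph V) (p : ℕ → V) (m : ℕ) : Prop where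
  adj : ∀ i < m, G.Adj (p i) (p (i + 1))
  far : ∀ i j, i + 2 ≤ j → j ≤ m → p i ≠ p j ∧ ¬ G.Adj (p i) (p j)

/-- A shortest walk has no shortcuts. -/
theorem exists_isInducedPath {V : Type*} {G : SimpleGraph V} {a b : V} (h : G.Reachable a b) :
    ∃ (m : ℕ) (p : ℕ → V), p 0 = a ∧ p m = b ∧ IsInducedPath G p m := by
  obtain ⟨w, hw⟩ := h.exists_walk_length_eq_dist
  refine ⟨w.length, w.getVert, w.getVert_zero, w.getVert_length,
    fun i hi => w.adj_getVert_succ hi, fun i j hij hj => ⟨fun e => ?_, fun e => ?_⟩⟩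
  · have := SimpleGraph.dist_le ((w.take i).append ((w.drop j).copy e.symm rfl))
    rw [SimpleGraph.Walk.length_append, SimpleGraph.Walk.length_copy,
      SimpleGraph.Walk.take_length, SimpleGraph.Walk.drop_length] at this
    omega
  · have := SimpleGraph.dist_le ((w.take i).append (SimpleGraph.Walk.cons e (w.drop j)))
    rw [SimpleGraph.Walk.length_append, SimpleGraph.Walk.length_cons,
      SimpleGraph.Walk.take_length, SimpleGraph.Walk.drop_length] at this
    omega

/-- Otherwise two consecutive neighbors of `k` on the path enclose a gap. With `k` it closes an
induced cycle of length four or five, or a longer one containing a forbidden pair of paths; the two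
adjacencies left open in `IsP3Pair` are needed here. -/
theorem IsInducedPath.adj_of_adj_ends {V : Type*} {G : SimpleGraph V} {A : Finset V}
    (hC4 : ∀ a ∈ A, ∀ b ∈ A, ∀ c ∈ A, ∀ d ∈ A, ¬ IsC4 G a b c d)
    (hC5 : ∀ a ∈ A, ∀ b ∈ A, ∀ c ∈ A, ∀ d ∈ A, ∀ e ∈ A, ¬ IsC5 G a b c d e)
    (hP3 : ∀ a₁ ∈ A, ∀ a₂ ∈ A, ∀ a₃ ∈ A, ∀ b₁ ∈ A, ∀ b₂ ∈ A, ∀ b₃ ∈ A,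
      ¬ IsP3Pair G a₁ a₂ a₃ b₁ b₂ b₃)
    {p : ℕ → V} {m : ℕ} (hp : IsInducedPath G p m) (hpA : ∀ i ≤ m, p i ∈ A) {k : V} (hkA : k ∈ A)
    (hk : ∀ i ≤ m, k ≠ p i) (h0 : G.Adj k (p 0)) (hm : G.Adj k (p m)) :
    ∀ i ≤ m, G.Adj k (p i) := by
  by_contra hno
  push Not at hno
  obtain ⟨i, him, hi⟩ := hno
  obtain ⟨a, b, hab, hbm, ha, hb, hgap⟩ := exists_gap (fun i => G.Adj k (p i)) h0 hm him hi
  have adj : ∀ i, i < m → G.Adj (p i) (p (i + 1)) := hp.adj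
  have A1 := adj a (by omega)
  have A2 : G.Adj (p (a + 1)) (p (a + 2)) := adj (a + 1) (by omega)
  have F1 := hp.far a (a + 2) (by omega) (by omega)
  have N1 := hgap (a + 1) (by omega)
  rcases (by omega : b = a + 2 ∨ b = a + 3 ∨ a + 4 ≤ b) with rfl | rfl | h4
  · exact hC4 k hkA (p a) (hpA _ (by omega)) (p (a + 1)) (hpA _ (by omega)) (p (a + 2))
      (hpA _ (by omega)) ⟨ha, A1, A2, hb.symm, hk _ (by omega), F1.1, N1 (by omega), F1.2⟩
  · have A3 : G.Adj (p (a + 2)) (p (a + 3)) := adj (a + 2) (by omega)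
    have F2 := hp.far (a + 1) (a + 3) (by omega) (by omega)
    have F3 := hp.far a (a + 3) (by omega) (by omega)
    have N2 := hgap (a + 2) (by omega) (by omega)
    exact hC5 k hkA (p a) (hpA _ (by omega)) (p (a + 1)) (hpA _ (by omega)) (p (a + 2))
      (hpA _ (by omega)) (p (a + 3)) (hpA _ (by omega)) ⟨ha, A1, A2, A3, hb.symm,
        hk _ (by omega), F1.1, F2.1, (hk _ (by omega)).symm, F3.1.symm, N1 (by omega), F1.2, F2.2,
        fun h => N2 h.symm, fun h => F3.2 h.symm⟩
  · have A3 : G.Adj (p (a + 2)) (p (a + 3)) := adj (a + 2) (by omega)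
    have A4 : G.Adj (p (a + 3)) (p (a + 4)) := adj (a + 3) (by omega)
    have F2 := hp.far (a + 1) (a + 3) (by omega) (by omega)
    have F3 := hp.far a (a + 3) (by omega) (by omega)
    have F4 := hp.far a (a + 4) (by omega) (by omega)
    have F5 := hp.far (a + 1) (a + 4) (by omega) (by omega)
    have F6 := hp.far (a + 2) (a + 4) (by omega) (by omega)
    have N2 := hgap (a + 2) (by omega) (by omega)
    have N3 := hgap (a + 3) (by omega) (by omega)
    exact hP3 k hkA (p a) (hpA _ (by omega)) (p (a + 1)) (hpA _ (by omega)) (p (a + 2))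
      (hpA _ (by omega)) (p (a + 3)) (hpA _ (by omega)) (p (a + 4)) (hpA _ (by omega))
      ⟨⟨ha, A1, hk _ (by omega), N1 (by omega)⟩, ⟨A3, A4, F6.1, F6.2⟩,
        ⟨hk _ (by omega), hk _ (by omega), hk _ (by omega), F1.1, F3.1, F4.1, A2.ne, F2.1, F5.1⟩,
        N2, N3, F1.2, F3.2, F4.2, F2.2, F5.2⟩

/-- The set `C` contains an induced path and is attached to the rest of `A` only through the clique
`K`. The search shrinks `C` until a clique next to it hits everything. -/
theorem exists_hitting_clique_of_isolated {V : Type*} {G : SimpleGraph V} {A : Finset V}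
    (hC4 : ∀ a ∈ A, ∀ b ∈ A, ∀ c ∈ A, ∀ d ∈ A, ¬ IsC4 G a b c d)
    (hC5 : ∀ a ∈ A, ∀ b ∈ A, ∀ c ∈ A, ∀ d ∈ A, ∀ e ∈ A, ¬ IsC5 G a b c d e)
    (hP3 : ∀ a₁ ∈ A, ∀ a₂ ∈ A, ∀ a₃ ∈ A, ∀ b₁ ∈ A, ∀ b₂ ∈ A, ∀ b₃ ∈ A,
      ¬ IsP3Pair G a₁ a₂ a₃ b₁ b₂ b₃) (C : Finset V) :
    ∀ K ⊆ A, C ⊆ A → G.IsClique K → Disjoint C K →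
      (∀ c ∈ C, ∀ a ∈ A, G.Adj c a → a ∈ C ∨ a ∈ K) → ¬ P3Free G C →
      ∃ Q ⊆ A, G.IsClique Q ∧ P3Free G (A \ Q) := by
  induction C using Finset.strongInduction with
  | H C ih =>
  intro K hKA hCA hK hdisj hclosed hC
  have hP := hC
  simp only [P3Free, not_forall] at hP
  obtain ⟨u', hu', v', hv', w', hw', huv', hvw', huw', hn'⟩ := hP
  set K' := K.filter fun k => ∃ c ∈ C, G.Adj k c with hK'
  have hK'K : K' ⊆ K := Finset.filter_subset _ _
  obtain ⟨c, hc, hmax⟩ := Finset.exists_max_image C (fun c => (K'.filter (G.Adj c)).card) ⟨u', hu'⟩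
  -- If `c` sees all of `K'`, then `c` and `K'` form a clique separating the rest of `C` from the
  -- rest of `A`.
  by_cases hfull : ∀ k ∈ K', G.Adj c k
  · have hQA : insert c K' ⊆ A := Finset.insert_subset (hCA hc) (hK'K.trans hKA)
    have hQ : G.IsClique (insert c K' : Finset V) := by
      rw [Finset.coe_insert]
      exact (hK.subset (by exact_mod_cast hK'K)).insert fun k hk _ => hfull k (by exact_mod_cast hk)
    have hclosed' : ∀ d ∈ C, ∀ a ∈ A, G.Adj d a → a ∉ insert c K' → a ∈ C := by
      intro d hd a ha hda haQ
      refine (hclosed d hd a ha hda).resolve_right fun haK => haQ ?_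
      exact Finset.mem_insert_of_mem (Finset.mem_filter.2 ⟨haK, d, hd, hda.symm⟩)
    by_cases hgood : P3Free G (A \ insert c K')
    · exact ⟨_, hQA, hQ, hgood⟩
    by_cases hsmall : P3Free G (C.erase c)
    -- An induced path missed by this clique lies outside of `C` and has no edge to the one inside
    -- `C`: a forbidden pair.
    · exfalso
      simp only [P3Free, not_forall] at hgood
      obtain ⟨u, hu, v, hv, w, hw, huv, hvw, huw, hn⟩ := hgood
      rw [Finset.mem_sdiff] at hu hv hw
      have herase : ∀ z, z ∉ insert c K' → z ∈ C → z ∈ C.erase c := fun z hz hzC =>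
        Finset.mem_erase.2 ⟨fun e => hz (e ▸ Finset.mem_insert_self _ _), hzC⟩
      have hvC : v ∉ C := fun h => hn (hsmall u
        (herase u hu.2 (hclosed' v h u hu.1 huv.symm hu.2)) v (herase v hv.2 h) w
        (herase w hw.2 (hclosed' v h w hw.1 hvw hw.2)) huv hvw huw)
      have huC : u ∉ C := fun h => hvC (hclosed' u h v hv.1 huv hv.2)
      have hwC : w ∉ C := fun h => hvC (hclosed' w h v hv.1 hvw.symm hv.2)
      have hne : ∀ z d, z ∉ C → d ∈ C → z ≠ d := fun z d hz hd e => hz (e ▸ hd)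
      have hna : ∀ z d, z ∈ A ∧ z ∉ insert c K' → z ∉ C → d ∈ C → ¬ G.Adj z d :=
        fun z d hz hzC hd h => hzC (hclosed' d hd z hz.1 h.symm hz.2)
      exact hP3 u hu.1 v hv.1 w hw.1 u' (hCA hu') v' (hCA hv') w' (hCA hw')
        ⟨⟨huv, hvw, huw, hn⟩, ⟨huv', hvw', huw', hn'⟩,
          ⟨hne _ _ huC hu', hne _ _ huC hv', hne _ _ huC hw', hne _ _ hvC hu', hne _ _ hvC hv',
            hne _ _ hvC hw', hne _ _ hwC hu', hne _ _ hwC hv', hne _ _ hwC hw'⟩,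
          hna _ _ hu huC hu', hna _ _ hu huC hv', hna _ _ hv hvC hu', hna _ _ hv hvC hv',
          hna _ _ hv hvC hw', hna _ _ hw hwC hv', hna _ _ hw hwC hw'⟩
    · refine ih _ (Finset.erase_ssubset hc) _ hQA ((Finset.erase_subset _ _).trans hCA) hQ ?_ ?_
        hsmall
      · rw [Finset.disjoint_insert_right]
        exact ⟨Finset.notMem_erase _ _, (hdisj.mono_left (Finset.erase_subset _ _)).mono_right hK'K⟩
      · intro d hd a ha hda
        by_cases haQ : a ∈ insert c K'
        · exact Or.inr haQ
        · refine Or.inl (Finset.mem_erase.2 ⟨fun e => haQ (e ▸ Finset.mem_insert_self _ _), ?_⟩)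
          exact hclosed' d (Finset.mem_of_mem_erase hd) a ha hda haQ
  · push Not at hfull
    obtain ⟨k, hk, hck⟩ := hfull
    have hkK := hK'K hk
    have hCK : ∀ d ∈ C, ∀ l ∈ K, d ≠ l := fun d hd l hl e =>
      Finset.disjoint_left.1 hdisj hd (e ▸ hl)
    -- The graph induced on `C` and `k`, with all other vertices isolated.
    set G' : SimpleGraph V :=
      SimpleGraph.fromRel fun a b => G.Adj a b ∧ a ∈ insert k C ∧ b ∈ insert k C with hG'
    have hadj : ∀ a b, G'.Adj a b ↔ G.Adj a b ∧ a ∈ insert k C ∧ b ∈ insert k C := by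
      intro a b
      rw [hG', SimpleGraph.fromRel_adj]
      constructor
      · rintro ⟨_, h | h⟩
        · exact h
        · exact ⟨h.1.symm, h.2.2, h.2.1⟩
      · intro h
        exact ⟨h.1.ne, Or.inl h⟩
    by_cases hreach : G'.Reachable c k
    · exfalso
      obtain ⟨m, p, hp0, hpm, hp⟩ := exists_isInducedPath hreach
      have hm : 0 < m := by
        rcases Nat.eq_zero_or_pos m with rfl | h
        · exact absurd (hp0.symm.trans hpm) (hCK c hc k hkK)
        · exact h
      have hT : ∀ i ≤ m, p i ∈ insert k C := by
        intro i hi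
        rcases hi.lt_or_eq with h | rfl
        · exact ((hadj _ _).1 (hp.adj i h)).2.1
        · rw [hpm]; exact Finset.mem_insert_self _ _
      have hpC : ∀ i < m, p i ∈ C := by
        intro i hi
        refine (Finset.mem_insert.1 (hT i hi.le)).resolve_left fun e => ?_
        rcases (by omega : i + 1 = m ∨ i + 2 ≤ m) with h | h
        · have := hp.adj i hi
          rw [h, hpm, e] at this
          exact this.ne rfl
        · exact (hp.far i m h le_rfl).1 (e.trans hpm.symm)
      have hpG : IsInducedPath G p m := by
        refine ⟨fun i hi => ((hadj _ _).1 (hp.adj i hi)).1, fun i j hij hj => ?_⟩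
        have := hp.far i j hij hj
        exact ⟨this.1, fun h => this.2 ((hadj _ _).2 ⟨h, hT i (by omega), hT j hj⟩)⟩
      have hlast : G.Adj (p (m - 1)) k := by
        have := hpG.adj (m - 1) (by omega)
        rwa [Nat.sub_add_cancel hm, hpm] at this
      -- Each neighbor of `c` in `K'` sees both ends of the path, hence also its last vertex before
      -- `k`. That vertex sees `k` too, contradicting the choice of `c`.
      have hsub : insert k (K'.filter (G.Adj c)) ⊆ K'.filter (G.Adj (p (m - 1))) := by
        refine Finset.insert_subset (Finset.mem_filter.2 ⟨hk, hlast⟩) fun l hl => ?_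
        obtain ⟨hlK', hcl⟩ := Finset.mem_filter.1 hl
        have hlK := hK'K hlK'
        have hlk : l ≠ k := fun e => hck (e ▸ hcl)
        refine Finset.mem_filter.2 ⟨hlK', ?_⟩
        refine (hpG.adj_of_adj_ends hC4 hC5 hP3 (fun i hi => ?_) (hKA hlK) (fun i hi => ?_)
          (hp0 ▸ hcl.symm) (hpm ▸ hK hlK hkK hlk) (m - 1) (by omega)).symm
        · exact Finset.insert_subset (hKA hkK) hCA (hT i hi)
        · rcases hi.lt_or_eq with h | rfl
          · exact (hCK _ (hpC i h) l hlK).symm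
          · rw [hpm]; exact hlk
      have h1 := Finset.card_le_card hsub
      rw [Finset.card_insert_of_notMem (by simp [hck])] at h1
      have h2 := hmax (p (m - 1)) (hpC _ (by omega))
      omega
    · obtain ⟨c', hc', hkc'⟩ := (Finset.mem_filter.1 hk).2
      -- The component of `c` in `C` misses `c'`, so `C` falls into two smaller parts, one of which
      -- contains the induced path.
      set D := C.filter fun d => G'.Reachable c d with hD
      have hDC : D ⊆ C := Finset.filter_subset _ _
      have hDD : ∀ d ∈ D, ∀ e ∈ C, G.Adj d e → e ∈ D := by
        intro d hd e he hde
        rw [hD, Finset.mem_filter] at hd ⊢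
        exact ⟨he, hd.2.trans (SimpleGraph.Adj.reachable ((hadj d e).2 ⟨hde,
          Finset.mem_insert_of_mem hd.1, Finset.mem_insert_of_mem he⟩))⟩
      have hcD : c ∈ D := Finset.mem_filter.2 ⟨hc, SimpleGraph.Reachable.refl _⟩
      have hc'D : c' ∉ D := fun h => hreach ((Finset.mem_filter.1 h).2.trans
        (SimpleGraph.Adj.reachable ((hadj c' k).2 ⟨hkc'.symm, Finset.mem_insert_of_mem hc',
          Finset.mem_insert_self _ _⟩)))
      by_cases hv'D : v' ∈ D
      · refine ih D ⟨hDC, fun h => hc'D (h hc')⟩ K hKA (hDC.trans hCA) hK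
          (hdisj.mono_left hDC) ?_ fun h => ?_
        · intro d hd a ha hda
          exact (hclosed d (hDC hd) a ha hda).imp_left fun h => hDD d hd a h hda
        · exact hn' (h u' (hDD v' hv'D u' hu' huv'.symm) v' hv'D w' (hDD v' hv'D w' hw' hvw')
            huv' hvw' huw')
      · have hu'D : u' ∉ D := fun h => hv'D (hDD u' h v' hv' huv')
        have hw'D : w' ∉ D := fun h => hv'D (hDD w' h v' hv' hvw'.symm)
        refine ih (C \ D) ⟨Finset.sdiff_subset, fun h => (Finset.mem_sdiff.1 (h hc)).2 hcD⟩ K hKA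
          (Finset.sdiff_subset.trans hCA) hK (hdisj.mono_left Finset.sdiff_subset) ?_ fun h => ?_
        · intro d hd a ha hda
          obtain ⟨hdC, hdD⟩ := Finset.mem_sdiff.1 hd
          exact (hclosed d hdC a ha hda).imp_left fun h => Finset.mem_sdiff.2
            ⟨h, fun haD => hdD (hDD a haD d hdC hda.symm)⟩
        · exact hn' (h u' (Finset.mem_sdiff.2 ⟨hu', hu'D⟩) v' (Finset.mem_sdiff.2 ⟨hv', hv'D⟩) w'
            (Finset.mem_sdiff.2 ⟨hw', hw'D⟩) huv' hvw' huw')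

theorem exists_hitting_clique {V : Type*} {G : SimpleGraph V} {A : Finset V}
    (hC4 : ∀ a ∈ A, ∀ b ∈ A, ∀ c ∈ A, ∀ d ∈ A, ¬ IsC4 G a b c d)
    (hC5 : ∀ a ∈ A, ∀ b ∈ A, ∀ c ∈ A, ∀ d ∈ A, ∀ e ∈ A, ¬ IsC5 G a b c d e)
    (hP3 : ∀ a₁ ∈ A, ∀ a₂ ∈ A, ∀ a₃ ∈ A, ∀ b₁ ∈ A, ∀ b₂ ∈ A, ∀ b₃ ∈ A,
      ¬ IsP3Pair G a₁ a₂ a₃ b₁ b₂ b₃) :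
    ∃ Q ⊆ A, G.IsClique Q ∧ P3Free G (A \ Q) := by
  by_cases h : P3Free G A
  · exact ⟨∅, Finset.empty_subset _, by simp, by simpa using h⟩
  · exact exists_hitting_clique_of_isolated hC4 hC5 hP3 A ∅ (Finset.empty_subset _) subset_rfl
      (by simp) (Finset.disjoint_empty_right _) (fun _ _ a ha _ => Or.inl ha) h

end HittingClique

/-! ### Weights on a twin-free graph with a universal vertex. -/

section Weights
open scoped Classical

theorem exists_maximal_hitting_clique {V : Type*} {G : SimpleGraph V} {A Q₀ : Finset V}
    (hQ₀A : Q₀ ⊆ A) (hQ₀ : G.IsClique Q₀) (hA : P3Free G (A \ Q₀)) :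
    ∃ Q ⊆ A, G.IsClique Q ∧ P3Free G (A \ Q) ∧ ∀ z ∈ A \ Q, ∃ q ∈ Q, ¬ G.Adj z q := by
  obtain ⟨Q, hQ, hmax⟩ := Finset.exists_max_image
    (A.powerset.filter fun Q : Finset V => G.IsClique (Q : Set V) ∧ P3Free G (A \ Q)) Finset.card
    ⟨Q₀, by simp [hQ₀A, hQ₀, hA]⟩
  simp only [Finset.mem_filter, Finset.mem_powerset] at hQ hmax
  refine ⟨Q, hQ.1, hQ.2.1, hQ.2.2, fun z hz => ?_⟩
  by_contra hno
  push Not at hno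
  obtain ⟨hzA, hzQ⟩ := Finset.mem_sdiff.1 hz
  have := hmax (insert z Q) ⟨Finset.insert_subset hzA hQ.1, ?_, hQ.2.2.mono
    (Finset.sdiff_subset_sdiff subset_rfl (Finset.subset_insert _ _))⟩
  · rw [Finset.card_insert_of_notMem hzQ] at this
    omega
  · rw [Finset.coe_insert]
    exact hQ.2.1.insert fun q hq _ => hno q hq

/-- Data for a clique `Q` of `A` such that `A \ Q` induces a cluster graph. -/
structure IsHittingClique {V : Type*} (G : SimpleGraph V) (A Q : Finset V) : Prop where
  subset : Q ⊆ A
  clique : G.IsClique Q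
  free : P3Free G (A \ Q)
  maximal : ∀ z ∈ A \ Q, ∃ q ∈ Q, ¬ G.Adj z q
  noC4 : ∀ a ∈ A, ∀ b ∈ A, ∀ c ∈ A, ∀ d ∈ A, ¬ IsC4 G a b c d
  twinFree : TwinFree G A

namespace IsHittingClique

variable {V : Type*} {G : SimpleGraph V} {A Q : Finset V}

/-- Incomparable neighborhoods of adjacent vertices would give an induced four-cycle through two
vertices of `Q`. -/
theorem nested (h : IsHittingClique G A Q) {z z' : V} (hz : z ∈ A \ Q) (hz' : z' ∈ A \ Q)
    (hzz' : G.Adj z z') :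
    Q.filter (G.Adj z) ⊆ Q.filter (G.Adj z') ∨ Q.filter (G.Adj z') ⊆ Q.filter (G.Adj z) := by
  by_contra hno
  rw [not_or, Finset.not_subset, Finset.not_subset] at hno
  obtain ⟨⟨q, hq, hq'⟩, p, hp, hp'⟩ := hno
  simp only [Finset.mem_filter, not_and] at hq hq' hp hp'
  have hqp : q ≠ p := fun e => hq' hq.1 (e ▸ hp.2)
  rw [Finset.mem_sdiff] at hz hz'
  exact h.noC4 z hz.1 q (h.subset hq.1) p (h.subset hp.1) z' hz'.1
    ⟨hq.2, h.clique hq.1 hp.1 hqp, hp.2.symm, hzz'.symm, fun e => hz.2 (e ▸ hp.1),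
      fun e => hz'.2 (e ▸ hq.1), hp' hp.1, fun e => hq' hq.1 e.symm⟩

/-- Adjacent vertices of `A \ Q` lie in one component, a clique, so only `Q` can distinguish them.
With `nested`, the neighborhoods in `Q` of a component form a strict chain, whose increments (the
last one up to `Q`) are the sets `step`. -/
theorem filter_ne (h : IsHittingClique G A Q) {z z' : V} (hz : z ∈ A \ Q) (hz' : z' ∈ A \ Q)
    (hzz' : G.Adj z z') : Q.filter (G.Adj z) ≠ Q.filter (G.Adj z') := by
  intro heq
  have hzA := (Finset.mem_sdiff.1 hz).1
  have hzA' := (Finset.mem_sdiff.1 hz').1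
  obtain ⟨a, ha, haz, haz', hs⟩ := h.twinFree z hzA z' hzA' hzz'
  have hiff : G.Adj a z ↔ G.Adj a z' := by
    by_cases haQ : a ∈ Q
    · have := Finset.ext_iff.1 heq a
      simp only [Finset.mem_filter, haQ, true_and] at this
      rw [G.adj_comm a z, G.adj_comm a z', this]
    · have haB : a ∈ A \ Q := Finset.mem_sdiff.2 ⟨ha, haQ⟩
      exact ⟨fun h' => h.free a haB z hz z' hz' h' hzz' haz',
        fun h' => h.free a haB z' hz' z hz h' hzz'.symm haz⟩
  obtain ⟨⟨u, hu, hau⟩, v, hv, hav⟩ := hs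
  simp only [Finset.mem_insert, Finset.mem_singleton] at hu hv
  rcases hu with rfl | rfl <;> rcases hv with rfl | rfl <;> tauto

/-- The vertices of `Q` that are not adjacent to `z`, but to all vertices of the component of `z`
in `A \ Q` that have more neighbors in `Q` than `z`. -/
noncomputable def step (G : SimpleGraph V) (A Q : Finset V) (z : V) : Finset V :=
  Q.filter fun q => ¬ G.Adj z q ∧ ∀ z' ∈ A \ Q, G.Adj z z' →
    Q.filter (G.Adj z) ⊆ Q.filter (G.Adj z') → G.Adj z' q

theorem step_nonempty (h : IsHittingClique G A Q) {z : V} (hz : z ∈ A \ Q) :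
    (step G A Q z).Nonempty := by
  set T := (A \ Q).filter fun z' => G.Adj z z' ∧ Q.filter (G.Adj z) ⊆ Q.filter (G.Adj z') with hT
  rcases T.eq_empty_or_nonempty with hemp | hne
  · obtain ⟨q, hq, hzq⟩ := h.maximal z hz
    refine ⟨q, Finset.mem_filter.2 ⟨hq, hzq, fun z' hz' hzz' hsub => ?_⟩⟩
    have : z' ∈ T := Finset.mem_filter.2 ⟨hz', hzz', hsub⟩
    simp [hemp] at this
  · obtain ⟨z', hz', hmin⟩ := Finset.exists_min_image T
      (fun z' => (Q.filter (G.Adj z')).card) hne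
    obtain ⟨hz'B, hzz', hsub⟩ := Finset.mem_filter.1 hz'
    obtain ⟨q, hq, hq'⟩ := Finset.exists_of_ssubset
      (hsub.ssubset_of_ne (h.filter_ne hz hz'B hzz'))
    rw [Finset.mem_filter] at hq
    refine ⟨q, Finset.mem_filter.2 ⟨hq.1, fun e => hq' (Finset.mem_filter.2 ⟨hq.1, e⟩),
      fun y hy hzy hsuby => ?_⟩⟩
    by_cases hyz' : z' = y
    · exact hyz' ▸ hq.2
    have hadj : G.Adj z' y := h.free z' hz'B z hz y hy hzz'.symm hzy hyz'
    have hle := hmin y (Finset.mem_filter.2 ⟨hy, hzy, hsuby⟩)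
    have hsub' : Q.filter (G.Adj z') ⊆ Q.filter (G.Adj y) := by
      rcases h.nested hz'B hy hadj with h' | h'
      · exact h'
      · rw [Finset.eq_of_subset_of_card_le h' hle]
    exact (Finset.mem_filter.1 (hsub' (Finset.mem_filter.2 hq))).2

theorem disjoint_step (h : IsHittingClique G A Q) {z z' : V} (hz : z ∈ A \ Q) (hz' : z' ∈ A \ Q)
    (hzz' : G.Adj z z') : Disjoint (step G A Q z) (step G A Q z') := by
  rw [Finset.disjoint_left]
  intro q hq hq'
  obtain ⟨-, h1, h2⟩ := Finset.mem_filter.1 hq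
  obtain ⟨-, h1', h2'⟩ := Finset.mem_filter.1 hq'
  rcases h.nested hz hz' hzz' with hs | hs
  · exact h1' (h2 z' hz' hzz' hs)
  · exact h1 (h2' z hz hzz'.symm hs)

/-- Among the vertices splitting `Q'`, take `z` with most neighbors in `Q`. Larger members of its
chain do not split `Q'`, so its step covers all non-neighbors of `z` in `Q'`. Recurse on the
neighbors, which `z` no longer splits. -/
theorem card_le_sum_splits (h : IsHittingClique G A Q) (Q' : Finset V) : Q' ⊆ Q →
    Q'.card ≤ 1 + ∑ z ∈ A \ Q with Splits G z Q', (step G A Q z ∩ Q').card := by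
  induction Q' using Finset.strongInduction with
  | H Q' ih =>
  intro hQ'
  by_cases h1 : Q'.card ≤ 1
  · omega
  obtain ⟨u, hu, v, hv, huv⟩ := Finset.one_lt_card.1 (not_le.1 h1)
  have hne : ((A \ Q).filter fun z => Splits G z Q').Nonempty := by
    obtain ⟨z, hz, hzu, hzv, hs⟩ := h.twinFree u (h.subset (hQ' hu)) v (h.subset (hQ' hv))
      (h.clique (hQ' hu) (hQ' hv) huv)
    refine ⟨z, Finset.mem_filter.2 ⟨Finset.mem_sdiff.2 ⟨hz, fun hzQ => ?_⟩, hs.mono ?_⟩⟩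
    · obtain ⟨t, ht, hzt⟩ := hs.2
      simp only [Finset.mem_insert, Finset.mem_singleton] at ht
      rcases ht with rfl | rfl
      · exact hzt (h.clique hzQ (hQ' hu) hzu)
      · exact hzt (h.clique hzQ (hQ' hv) hzv)
    · exact Finset.insert_subset hu (Finset.singleton_subset_iff.2 hv)
  obtain ⟨z, hz, hmax⟩ := Finset.exists_max_image _ (fun z => (Q.filter (G.Adj z)).card) hne
  obtain ⟨hzB, hzs⟩ := Finset.mem_filter.1 hz
  obtain ⟨⟨a, ha, hza⟩, b, hb, hzb⟩ := id hzs
  have hstep : step G A Q z ∩ Q' = Q'.filter (¬ G.Adj z ·) := by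
    ext q
    simp only [step, Finset.mem_inter, Finset.mem_filter]
    refine ⟨fun hq => ⟨hq.2, hq.1.2.1⟩, fun hq => ⟨⟨hQ' hq.1, hq.2, fun z' hz' hzz' hsub => ?_⟩,
      hq.1⟩⟩
    by_contra hn
    have hz's : Splits G z' Q' := ⟨⟨a, ha, (Finset.mem_filter.1
      (hsub (Finset.mem_filter.2 ⟨hQ' ha, hza⟩))).2⟩, q, hq.1, hn⟩
    exact h.filter_ne hzB hz' hzz' (Finset.eq_of_subset_of_card_le hsub
      (hmax z' (Finset.mem_filter.2 ⟨hz', hz's⟩)))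
  have hIH := ih (Q'.filter (G.Adj z)) (Finset.filter_ssubset.2 ⟨b, hb, hzb⟩)
    ((Finset.filter_subset _ _).trans hQ')
  have hcard : (Q'.filter (G.Adj z)).card + (Q'.filter (¬ G.Adj z ·)).card = Q'.card :=
    Finset.card_filter_add_card_filter_not _
  have hnot : z ∉ (A \ Q).filter fun y => Splits G y (Q'.filter (G.Adj z)) := by
    intro hz'
    obtain ⟨t, ht, hzt⟩ := (Finset.mem_filter.1 hz').2.2
    exact hzt (Finset.mem_filter.1 ht).2
  have hsub : insert z ((A \ Q).filter fun y => Splits G y (Q'.filter (G.Adj z)))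
      ⊆ (A \ Q).filter fun y => Splits G y Q' :=
    Finset.insert_subset hz (Finset.monotone_filter_right _ fun t _ ht =>
      ht.mono (Finset.filter_subset _ _))
  have h2 := Finset.sum_le_sum_of_subset (f := fun y => (step G A Q y ∩ Q').card) hsub
  rw [Finset.sum_insert hnot, hstep] at h2
  have h3 : ∑ y ∈ A \ Q with Splits G y (Q'.filter (G.Adj z)),
      (step G A Q y ∩ Q'.filter (G.Adj z)).card
      ≤ ∑ y ∈ A \ Q with Splits G y (Q'.filter (G.Adj z)), (step G A Q y ∩ Q').card :=
    Finset.sum_le_sum fun y _ => Finset.card_le_card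
      (Finset.inter_subset_inter_left (Finset.filter_subset _ _))
  omega

/-- Weight one on `Q`, and the size of the step on the other vertices. -/
noncomputable def weight (G : SimpleGraph V) (A Q : Finset V) (v : V) : ℕ :=
  if v ∈ Q then 1 else (step G A Q v).card

theorem sum_weight (S : Finset V) :
    ∑ v ∈ S, weight G A Q v = (S ∩ Q).card + ∑ v ∈ S \ Q, (step G A Q v).card := by
  rw [← Finset.sum_inter_add_sum_sdiff S Q, Finset.card_eq_sum_ones]
  congr 1
  · exact Finset.sum_congr rfl fun v hv => if_pos (Finset.mem_inter.1 hv).2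
  · exact Finset.sum_congr rfl fun v hv => if_neg (Finset.mem_sdiff.1 hv).2

theorem one_le_weight (h : IsHittingClique G A Q) {v : V} (hv : v ∈ A) : 1 ≤ weight G A Q v := by
  unfold weight
  split_ifs with hvQ
  · exact le_rfl
  · exact Finset.card_pos.2 (h.step_nonempty (Finset.mem_sdiff.2 ⟨hv, hvQ⟩))

/-- The vertices of `K` in `Q` and the steps of the others are disjoint subsets of `Q`. -/
theorem sum_weight_clique_le (h : IsHittingClique G A Q) {K : Finset V} (hKA : K ⊆ A)
    (hK : G.IsClique K) : ∑ v ∈ K, weight G A Q v ≤ Q.card := by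
  have hB : K \ Q ⊆ A \ Q := Finset.sdiff_subset_sdiff hKA subset_rfl
  rw [sum_weight, ← Finset.card_biUnion, ← Finset.card_union_of_disjoint]
  · refine Finset.card_le_card (Finset.union_subset Finset.inter_subset_right ?_)
    exact Finset.biUnion_subset.2 fun z _ => Finset.filter_subset _ _
  · rw [Finset.disjoint_biUnion_right]
    intro z hz
    rw [Finset.disjoint_left]
    intro q hq hqz
    rw [Finset.mem_inter] at hq
    obtain ⟨hzK, hzQ⟩ := Finset.mem_sdiff.1 hz
    exact (Finset.mem_filter.1 hqz).2.1 (hK hzK hq.1 fun e => hzQ (e ▸ hq.2))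
  · intro z hz z' hz' hne
    exact h.disjoint_step (hB hz) (hB hz')
      (hK (Finset.mem_sdiff.1 hz).1 (Finset.mem_sdiff.1 hz').1 hne)

/-- The set `S` misses `Q \ S` and every vertex outside of `Q` that splits `S ∩ Q`. By
`card_le_sum_splits` these weigh at least `|Q| - 1`. -/
theorem sum_weight_free_add_le (h : IsHittingClique G A Q) {S : Finset V} (hSA : S ⊆ A)
    (hS : P3Free G S) :
    ∑ v ∈ S, weight G A Q v + Q.card ≤ ∑ v ∈ A, weight G A Q v + 1 := by
  have h1 := Finset.sum_sdiff (f := weight G A Q) hSA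
  rw [sum_weight (A \ S)] at h1
  have h2 := h.card_le_sum_splits (S ∩ Q) Finset.inter_subset_right
  have h3 : ∑ z ∈ A \ Q with Splits G z (S ∩ Q), (step G A Q z ∩ (S ∩ Q)).card
      ≤ ∑ z ∈ (A \ S) \ Q, (step G A Q z).card := by
    refine (Finset.sum_le_sum fun z _ => Finset.card_le_card Finset.inter_subset_left).trans
      (Finset.sum_le_sum_of_subset fun z hz => ?_)
    obtain ⟨hzB, ⟨u, hu, hzu⟩, v, hv, hzv⟩ := Finset.mem_filter.1 hz
    obtain ⟨hzA, hzQ⟩ := Finset.mem_sdiff.1 hzB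
    rw [Finset.mem_inter] at hu hv
    refine Finset.mem_sdiff.2 ⟨Finset.mem_sdiff.2 ⟨hzA, fun hzS => hzv ?_⟩, hzQ⟩
    exact hS z hzS u hu.1 v hv.1 hzu (h.clique hu.2 hv.2 fun e => hzv (e ▸ hzu))
      fun e => hzQ (e ▸ hv.2)
  have h4 : ((A \ S) ∩ Q).card + (S ∩ Q).card = Q.card := by
    have : (A \ S) ∩ Q = Q \ S := by
      ext v
      simp only [Finset.mem_inter, Finset.mem_sdiff]
      exact ⟨fun hv => ⟨hv.2, hv.1.2⟩, fun hv => ⟨⟨h.subset hv.1, hv.2⟩, hv.1⟩⟩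
    rw [this, Finset.inter_comm S Q]
    exact Finset.card_sdiff_add_card_inter Q S
  omega

/-- Since no vertex of `Q` is universal in `A`, the steps cover `Q`. -/
theorem two_mul_card_le (h : IsHittingClique G A Q)
    (huniv : ∀ u ∈ A, ∃ z ∈ A, z ≠ u ∧ ¬ G.Adj z u) :
    2 * Q.card ≤ ∑ v ∈ A, weight G A Q v := by
  have hcover : Q ⊆ (A \ Q).biUnion (step G A Q) := by
    intro q hq
    have hne : ((A \ Q).filter fun z => ¬ G.Adj z q).Nonempty := by
      obtain ⟨z, hz, hzq, hn⟩ := huniv q (h.subset hq)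
      exact ⟨z, Finset.mem_filter.2 ⟨Finset.mem_sdiff.2 ⟨hz, fun hzQ =>
        hn (h.clique hzQ hq hzq)⟩, hn⟩⟩
    obtain ⟨z, hz, hmax⟩ := Finset.exists_max_image _ (fun z => (Q.filter (G.Adj z)).card) hne
    obtain ⟨hzB, hzq⟩ := Finset.mem_filter.1 hz
    refine Finset.mem_biUnion.2 ⟨z, hzB, Finset.mem_filter.2 ⟨hq, hzq, fun y hy hzy hsub => ?_⟩⟩
    by_contra hyq
    exact h.filter_ne hzB hy hzy (Finset.eq_of_subset_of_card_le hsub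
      (hmax y (Finset.mem_filter.2 ⟨hy, hyq⟩)))
  have h1 := (Finset.card_le_card hcover).trans Finset.card_biUnion_le
  rw [sum_weight, Finset.inter_eq_right.2 h.subset]
  omega

end IsHittingClique

/-- A twin-free graph with a universal vertex `o`, without induced cycles on four vertices, and
with a hitting clique has a weight function such that no `P3Free` set has more than half of the
total weight, up to rounding. -/
theorem exists_weights_of_universal {V : Type*} {G : SimpleGraph V} {R Q₀ : Finset V} {o : V}
    (ho : o ∈ R) (hadj : ∀ v ∈ R, v ≠ o → G.Adj o v) (htwin : TwinFree G R)
    (hC4 : ∀ a ∈ R, ∀ b ∈ R, ∀ c ∈ R, ∀ d ∈ R, ¬ IsC4 G a b c d)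
    (hQ₀A : Q₀ ⊆ R.erase o) (hQ₀ : G.IsClique Q₀) (hA : P3Free G (R.erase o \ Q₀)) :
    ∃ c : V → ℕ, (∀ v ∈ R, 1 ≤ c v) ∧
      ∀ S ⊆ R, P3Free G S → 2 * ∑ v ∈ S, c v ≤ ∑ v ∈ R, c v + 1 := by
  obtain ⟨Q, hQA, hQ, hfree, hmax⟩ := exists_maximal_hitting_clique hQ₀A hQ₀ hA
  set A := R.erase o with hAdef
  have hAR : A ⊆ R := Finset.erase_subset _ _
  have hoA : ∀ v ∈ A, G.Adj o v := fun v hv =>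
    hadj v (hAR hv) (Finset.ne_of_mem_erase hv)
  have h : IsHittingClique G A Q := by
    refine ⟨hQA, hQ, hfree, hmax, fun a ha b hb c hc d hd => hC4 a (hAR ha) b (hAR hb) c (hAR hc) d
      (hAR hd), fun u hu v hv huv => ?_⟩
    obtain ⟨z, hz, hzu, hzv, hs⟩ := htwin u (hAR hu) v (hAR hv) huv
    refine ⟨z, Finset.mem_erase.2 ⟨fun e => ?_, hz⟩, hzu, hzv, hs⟩
    obtain ⟨t, ht, hzt⟩ := hs.2
    simp only [Finset.mem_insert, Finset.mem_singleton] at ht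
    rcases ht with rfl | rfl
    · exact hzt (e ▸ hoA _ hu)
    · exact hzt (e ▸ hoA _ hv)
  have huniv : ∀ u ∈ A, ∃ z ∈ A, z ≠ u ∧ ¬ G.Adj z u := by
    intro u hu
    obtain ⟨z, hz, hzo, hzu, hs⟩ := htwin o ho u (hAR hu) (hoA u hu)
    have hzA : z ∈ A := Finset.mem_erase.2 ⟨hzo, hz⟩
    obtain ⟨t, ht, hzt⟩ := hs.2
    simp only [Finset.mem_insert, Finset.mem_singleton] at ht
    rcases ht with rfl | rfl
    · exact absurd (hoA z hzA).symm hzt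
    · exact ⟨z, hzA, hzu, hzt⟩
  have h2 := h.two_mul_card_le huniv
  set W := ∑ v ∈ A, IsHittingClique.weight G A Q v with hW
  -- This weight of `o` balances the two cases: `P3Free` sets with `o` and those without both get at
  -- most `W + 1 - |Q|`. It is positive because `2 * |Q| ≤ W`.
  set c : V → ℕ := fun v => if v = o then W + 1 - 2 * Q.card else IsHittingClique.weight G A Q v
    with hc
  have hcA : ∀ S ⊆ A, ∑ v ∈ S, c v = ∑ v ∈ S, IsHittingClique.weight G A Q v := fun S hS =>
    Finset.sum_congr rfl fun v hv => if_neg (Finset.ne_of_mem_erase (hS hv))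
  have hco : c o = W + 1 - 2 * Q.card := if_pos rfl
  refine ⟨c, fun v hv => ?_, fun S hS hP => ?_⟩
  · by_cases hvo : v = o
    · rw [hvo, hco]; omega
    · rw [hc]
      simp only [if_neg hvo]
      exact h.one_le_weight (Finset.mem_erase.2 ⟨hvo, hv⟩)
  · rw [← Finset.add_sum_erase R c ho, hcA _ subset_rfl, hco, ← hW]
    by_cases hoS : o ∈ S
    · have hSA : S.erase o ⊆ A := Finset.erase_subset_erase o hS
      have hK : G.IsClique (S.erase o : Finset V) := fun u hu v hv huv =>
        hP u (Finset.mem_of_mem_erase hu) o hoS v (Finset.mem_of_mem_erase hv)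
          (hoA u (hSA hu)).symm (hoA v (hSA hv)) huv
      have h3 := h.sum_weight_clique_le hSA hK
      rw [← Finset.add_sum_erase S c hoS, hcA _ hSA, hco]
      omega
    · have hSA : S ⊆ A := fun v hv => Finset.mem_erase.2 ⟨fun e => hoS (e ▸ hv), hS hv⟩
      have h3 := h.sum_weight_free_add_le hSA hP
      rw [hcA S hSA]
      omega

end Weights

/-! ### From twin class representatives to the whole closed neighborhood. -/

section Blowup
open scoped Classical

theorem exists_transversal {α β : Type*} (f : α → β) {F : Finset α} {o : α} (ho : o ∈ F) :
    ∃ R ⊆ F, o ∈ R ∧ (∀ u ∈ R, ∀ v ∈ R, f u = f v → u = v) ∧ ∀ v ∈ F, ∃ ρ ∈ R, f ρ = f v := by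
  obtain ⟨R, hR, hmax⟩ := Finset.exists_max_image
    (F.powerset.filter fun R : Finset α => o ∈ R ∧ ∀ u ∈ R, ∀ v ∈ R, f u = f v → u = v)
    Finset.card ⟨{o}, by simp [ho]⟩
  simp only [Finset.mem_filter, Finset.mem_powerset] at hR hmax
  obtain ⟨hRF, hoR, hinj⟩ := hR
  refine ⟨R, hRF, hoR, hinj, fun v hv => ?_⟩
  by_contra hno
  push Not at hno
  have hvR : v ∉ R := fun h => hno v h rfl
  have := hmax (insert v R) ⟨Finset.insert_subset hv hRF, Finset.mem_insert_of_mem hoR, ?_⟩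
  · rw [Finset.card_insert_of_notMem hvR] at this
    omega
  · intro a ha b hb hab
    rcases Finset.mem_insert.1 ha with rfl | ha' <;> rcases Finset.mem_insert.1 hb with rfl | hb'
    · rfl
    · exact absurd hab.symm (hno b hb')
    · exact absurd hab (hno a ha')
    · exact hinj a ha' b hb' hab

/-- The closed neighborhood of `v` within `F`. -/
noncomputable def closedNbhd {V : Type*} (G : SimpleGraph V) (F : Finset V) (v : V) : Finset V :=
  F.filter fun z => z = v ∨ G.Adj v z

theorem mem_closedNbhd_comm {V : Type*} {G : SimpleGraph V} {F : Finset V} {u v : V} (hu : u ∈ F)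
    (hv : v ∈ F) : u ∈ closedNbhd G F v ↔ v ∈ closedNbhd G F u := by
  simp only [closedNbhd, Finset.mem_filter, hu, hv, true_and, eq_comm, G.adj_comm]

theorem adj_iff_of_closedNbhd_eq {V : Type*} {G : SimpleGraph V} {F : Finset V} {u u' v v' : V}
    (hu' : u' ∈ F) (hv : v ∈ F) (hv' : v' ∈ F)
    (h : closedNbhd G F u = closedNbhd G F u') (h' : closedNbhd G F v = closedNbhd G F v')
    (hne : u ≠ v) (hne' : u' ≠ v') : G.Adj u v ↔ G.Adj u' v' := by
  have h1 : v ∈ closedNbhd G F u ↔ G.Adj u v := by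
    simp [closedNbhd, hv, hne.symm]
  have h2 : v' ∈ closedNbhd G F u' ↔ G.Adj u' v' := by
    simp [closedNbhd, hv', hne'.symm]
  rw [← h1, ← h2, h, mem_closedNbhd_comm hv hu', h', mem_closedNbhd_comm hu' hv']

/-- The twin class of `v` in `F`. -/
noncomputable def twinClass {V : Type*} (G : SimpleGraph V) (F : Finset V) (v : V) : Finset V :=
  F.filter fun u => closedNbhd G F u = closedNbhd G F v

theorem twinClass_subset {V : Type*} (G : SimpleGraph V) (F : Finset V) (v : V) :
    twinClass G F v ⊆ F :=
  Finset.filter_subset _ _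

theorem twinClass_isClique {V : Type*} (G : SimpleGraph V) (F : Finset V) (v : V) :
    G.IsClique (twinClass G F v) := by
  intro a ha b hb hab
  simp only [twinClass, Finset.coe_filter, Set.mem_ofPred_eq] at ha hb
  have : b ∈ closedNbhd G F a := by
    rw [ha.2, ← hb.2]
    simp [closedNbhd, hb.1]
  exact ((Finset.mem_filter.1 this).2).resolve_left hab.symm

/-- Vertices that are twins within `F` but not within `U` are told apart outside of `F`, so a clique
gadget for the class can live there. -/
theorem exists_twinClass_gadget {V : Type*} {G : SimpleGraph V} {U F : Finset V} (hFU : F ⊆ U)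
    (htwin : TwinFree G U) {v : V} (hv : v ∈ F) :
    ∃ w : V → ℕ, (∀ z, w z ≠ 0 → z ∈ U \ F) ∧ ∑ z ∈ U \ F, w z + 1 = (twinClass G F v).card ∧
      ∀ S, P3Free G S → ∑ z ∈ S, w z + 1 ≤ (twinClass G F v).card ∧
        ((S ∩ twinClass G F v).Nonempty →
          (S ∩ twinClass G F v).card + ∑ z ∈ S, w z ≤ (twinClass G F v).card) := by
  refine exists_clique_gadget G (U \ F) (twinClass G F v) ⟨v, by simp [twinClass, hv]⟩
    (twinClass_isClique G F v) (Finset.sdiff_disjoint.mono_right (Finset.filter_subset _ _)) ?_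
  intro a ha b hb hab
  have hadj := twinClass_isClique G F v ha hb hab
  obtain ⟨haF, ha⟩ := Finset.mem_filter.1 ha
  obtain ⟨hbF, hb⟩ := Finset.mem_filter.1 hb
  obtain ⟨z, hz, hza, hzb, hs⟩ := htwin a (hFU haF) b (hFU hbF) hadj
  refine ⟨z, Finset.mem_sdiff.2 ⟨hz, fun hzF => ?_⟩, hs⟩
  have hiff : G.Adj z a ↔ G.Adj z b :=
    adj_iff_of_closedNbhd_eq hzF haF hbF rfl (ha.trans hb.symm) hza hzb
  obtain ⟨⟨s, hs, hzs⟩, t, ht, hzt⟩ := hs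
  simp only [Finset.mem_insert, Finset.mem_singleton] at hs ht
  rcases hs with rfl | rfl <;> rcases ht with rfl | rfl <;> tauto

/-- A vertex of `F` that distinguishes two representatives may be replaced by its own
representative. -/
theorem twinFree_transversal {V : Type*} {G : SimpleGraph V} {F R : Finset V} (hRF : R ⊆ F)
    (hinj : ∀ u ∈ R, ∀ v ∈ R, closedNbhd G F u = closedNbhd G F v → u = v)
    (hsurj : ∀ v ∈ F, ∃ ρ ∈ R, closedNbhd G F ρ = closedNbhd G F v) : TwinFree G R := by
  have key : ∀ u ∈ R, ∀ v ∈ R, G.Adj u v → ∀ z ∈ closedNbhd G F u, z ∉ closedNbhd G F v →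
      ∃ z ∈ R, z ≠ u ∧ z ≠ v ∧ G.Adj z u ∧ ¬ G.Adj z v := by
    intro u hu v hv huv z hzu hzv
    have hzF := (Finset.mem_filter.1 hzu).1
    obtain ⟨ρ, hρ, hρz⟩ := hsurj z hzF
    rw [mem_closedNbhd_comm hzF (hRF hu), ← hρz] at hzu
    rw [mem_closedNbhd_comm hzF (hRF hv), ← hρz] at hzv
    simp only [closedNbhd, Finset.mem_filter, hRF hu, hRF hv, true_and, not_or] at hzu hzv
    have hρu : u ≠ ρ := fun e => hzv.2 (e ▸ huv)
    exact ⟨ρ, hρ, hρu.symm, Ne.symm hzv.1, hzu.resolve_left hρu, hzv.2⟩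
  intro u hu v hv huv
  have hne : closedNbhd G F u ≠ closedNbhd G F v := fun e => huv.ne (hinj u hu v hv e)
  rw [Ne, Finset.ext_iff, not_forall] at hne
  obtain ⟨z, hz⟩ := hne
  by_cases hzu : z ∈ closedNbhd G F u
  · obtain ⟨y, hy, hyu, hyv, h1, h2⟩ := key u hu v hv huv z hzu (by tauto)
    exact ⟨y, hy, hyu, hyv, ⟨u, by simp, h1⟩, v, by simp, h2⟩
  · obtain ⟨y, hy, hyv, hyu, h1, h2⟩ := key v hv u hu huv.symm z (by tauto) hzu
    exact ⟨y, hy, hyu, hyv, ⟨v, by simp, h1⟩, u, by simp, h2⟩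

theorem exists_weights_blowup {V : Type*} {G : SimpleGraph V} {U F R : Finset V} (hFU : F ⊆ U)
    (htwin : TwinFree G U) (hRF : R ⊆ F)
    (hinj : ∀ u ∈ R, ∀ v ∈ R, closedNbhd G F u = closedNbhd G F v → u = v)
    (hsurj : ∀ v ∈ F, ∃ ρ ∈ R, closedNbhd G F ρ = closedNbhd G F v)
    {cR : V → ℕ} (hcR : ∀ v ∈ R, 1 ≤ cR v)
    (hhalf : ∀ S ⊆ R, P3Free G S → 2 * ∑ v ∈ S, cR v ≤ ∑ v ∈ R, cR v + 1) :
    ∃ c : V → ℕ, (∀ v ∈ F, 1 ≤ c v) ∧ (U.filter (c · ≠ 0)).card ≤ 2 * F.card ∧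
      ∀ S ⊆ U, P3Free G S → 2 * ∑ v ∈ S, c v ≤ ∑ v ∈ U, c v + 1 := by
  have hself : ∀ ρ ∈ R, ρ ∈ twinClass G F ρ := fun ρ hρ => by simp [twinClass, hRF hρ]
  choose! w hw hws hwS using fun (ρ : V) (hρ : ρ ∈ R) =>
    exists_twinClass_gadget hFU htwin (hRF hρ)
  have hfiber : ∀ S : Finset V, (S ∩ F).card = ∑ ρ ∈ R, (S ∩ twinClass G F ρ).card := by
    intro S
    rw [← Finset.card_biUnion]
    · congr 1
      ext v
      simp only [Finset.mem_inter, Finset.mem_biUnion, twinClass, Finset.mem_filter]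
      constructor
      · rintro ⟨hvS, hvF⟩
        obtain ⟨ρ, hρ, h⟩ := hsurj v hvF
        exact ⟨ρ, hρ, hvS, hvF, h.symm⟩
      · rintro ⟨ρ, -, hvS, hvF, -⟩
        exact ⟨hvS, hvF⟩
    · intro ρ hρ σ hσ hne
      rw [Function.onFun, Finset.disjoint_left]
      intro v hv hv'
      simp only [Finset.mem_inter, twinClass, Finset.mem_filter] at hv hv'
      exact hne (hinj ρ hρ σ hσ (hv.2.2.symm.trans hv'.2.2))
  -- A class of size `t` represented by `ρ`, with its gadget, weighs `2 * (t - 1) + cR ρ`. A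
  -- `P3Free` set gets at most `t - 1` of it, and at most `cR ρ` more if it meets the class.
  set c : V → ℕ := fun v => (if v ∈ F then 1 else 0) + (if v ∈ R then cR v - 1 else 0)
    + ∑ ρ ∈ R, w ρ v with hc
  have hsum : ∀ S : Finset V, ∑ v ∈ S, c v = ∑ ρ ∈ R, ((S ∩ twinClass G F ρ).card
      + (if ρ ∈ S then cR ρ - 1 else 0) + ∑ v ∈ S, w ρ v) := by
    intro S
    simp only [hc, Finset.sum_add_distrib]
    rw [Finset.sum_ite_mem, Finset.sum_ite_mem, Finset.sum_ite_mem, Finset.inter_comm R S,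
      ← Finset.card_eq_sum_ones, hfiber, Finset.sum_comm]
  refine ⟨c, fun v hv => ?_, ?_, fun S _ hP => ?_⟩
  · simp only [hc, if_pos hv]; omega
  · have hsub : U.filter (c · ≠ 0) ⊆ F ∪ (U \ F).filter fun v => ∑ ρ ∈ R, w ρ v ≠ 0 := by
      intro v hv
      obtain ⟨hvU, hv⟩ := Finset.mem_filter.1 hv
      by_cases hvF : v ∈ F
      · exact Finset.mem_union_left _ hvF
      · refine Finset.mem_union_right _ (Finset.mem_filter.2
          ⟨Finset.mem_sdiff.2 ⟨hvU, hvF⟩, fun h => hv ?_⟩)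
        simp only [hc, if_neg hvF, if_neg fun h => hvF (hRF h), h]
    have h1 : ((U \ F).filter fun v => ∑ ρ ∈ R, w ρ v ≠ 0).card ≤ F.card := by
      calc ((U \ F).filter fun v => ∑ ρ ∈ R, w ρ v ≠ 0).card
          ≤ ∑ v ∈ (U \ F).filter fun v => ∑ ρ ∈ R, w ρ v ≠ 0, ∑ ρ ∈ R, w ρ v := by
            rw [Finset.card_eq_sum_ones]
            exact Finset.sum_le_sum fun v hv =>
              Nat.one_le_iff_ne_zero.2 (Finset.mem_filter.1 hv).2
        _ = ∑ ρ ∈ R, ∑ v ∈ U \ F, w ρ v := by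
            rw [Finset.sum_filter_ne_zero, Finset.sum_comm]
        _ ≤ ∑ ρ ∈ R, (F ∩ twinClass G F ρ).card := by
            refine Finset.sum_le_sum fun ρ hρ => ?_
            have := hws ρ hρ
            rw [Finset.inter_eq_right.2 (twinClass_subset G F ρ)]
            omega
        _ = F.card := by rw [← hfiber, Finset.inter_self]
    have h2 := (Finset.card_le_card hsub).trans (Finset.card_union_le _ _)
    omega
  · set T := R.filter fun ρ => (S ∩ twinClass G F ρ).Nonempty with hT
    -- Choosing a vertex of `S` from each class it meets gives an isomorphic copy of the graph on
    -- `T` inside `S`.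
    have hTP : P3Free G T := by
      have hrep : ∀ ρ ∈ T, ∃ u ∈ S, u ∈ F ∧ closedNbhd G F u = closedNbhd G F ρ := by
        intro ρ hρ
        obtain ⟨u, hu⟩ := (Finset.mem_filter.1 hρ).2
        obtain ⟨hu, hu'⟩ := Finset.mem_inter.1 hu
        exact ⟨u, hu, Finset.mem_filter.1 hu'⟩
      have hTR : ∀ ρ ∈ T, ρ ∈ R := fun ρ hρ => (Finset.mem_filter.1 hρ).1
      intro a ha b hb d hd hab hbd had
      obtain ⟨a', ha', haF, haa⟩ := hrep a ha
      obtain ⟨b', hb', hbF, hbb⟩ := hrep b hb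
      obtain ⟨d', hd', hdF, hdd⟩ := hrep d hd
      have hne : ∀ {p p' q q' : V}, p ∈ R → q ∈ R → p ≠ q →
          closedNbhd G F p' = closedNbhd G F p → closedNbhd G F q' = closedNbhd G F q →
          p' ≠ q' := fun {p p' q q'} hp hq hpq h h' e =>
        hpq (hinj p hp q hq (by rw [← h, ← h', e]))
      have nab := hne (hTR a ha) (hTR b hb) hab.ne haa hbb
      have nbd := hne (hTR b hb) (hTR d hd) hbd.ne hbb hdd
      have nad := hne (hTR a ha) (hTR d hd) had haa hdd
      have memF : ∀ ρ ∈ T, ρ ∈ F := fun ρ hρ => hRF (hTR ρ hρ)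
      refine (adj_iff_of_closedNbhd_eq (memF a ha) hdF (memF d hd) haa hdd nad had).1
        (hP a' ha' b' hb' d' hd' ?_ ?_ nad)
      · exact (adj_iff_of_closedNbhd_eq (memF a ha) hbF (memF b hb) haa hbb nab hab.ne).2 hab
      · exact (adj_iff_of_closedNbhd_eq (memF b hb) hdF (memF d hd) hbb hdd nbd hbd.ne).2 hbd
    have hle : ∑ v ∈ S, c v ≤ ∑ ρ ∈ R, ((twinClass G F ρ).card - 1) + ∑ ρ ∈ T, cR ρ := by
      rw [hsum, hT, Finset.sum_filter, ← Finset.sum_add_distrib]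
      refine Finset.sum_le_sum fun ρ hρ => ?_
      obtain ⟨h1, h2⟩ := hwS ρ hρ S hP
      have h3 := hcR ρ hρ
      split_ifs with hρS hne hne
      · have := h2 hne
        omega
      · exact absurd ⟨ρ, Finset.mem_inter.2 ⟨hρS, hself ρ hρ⟩⟩ hne
      · have := h2 hne
        omega
      · rw [Finset.not_nonempty_iff_eq_empty.1 hne, Finset.card_empty]
        omega
    have hU : ∑ v ∈ U, c v = ∑ ρ ∈ R, 2 * ((twinClass G F ρ).card - 1) + ∑ ρ ∈ R, cR ρ := by
      rw [hsum, ← Finset.sum_add_distrib]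
      refine Finset.sum_congr rfl fun ρ hρ => ?_
      have h1 := hws ρ hρ
      have h2 : ∑ v ∈ U, w ρ v = ∑ v ∈ U \ F, w ρ v := by
        refine (Finset.sum_subset Finset.sdiff_subset fun v _ hv => ?_).symm
        by_contra h
        exact hv (hw ρ hρ v h)
      have h3 := hcR ρ hρ
      rw [Finset.inter_eq_right.2 ((twinClass_subset G F ρ).trans hFU),
        if_pos (hFU (hRF hρ)), h2]
      omega
    have := hhalf T (Finset.filter_subset _ _) hTP
    rw [← Finset.mul_sum] at hU
    omega

/-- The weights of a local ratio step at the vertex `o`. -/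
theorem exists_local_ratio_weights {V : Type*} {G : SimpleGraph V} {r : ℕ} {x : V → ℝ} {ε : ℝ}
    (hx : LocallyFeasible G r x) (hε : 0 < ε) {U : Finset V} (hsmall : ∀ v ∈ U, (2 + ε) * x v < 1)
    (htwin : TwinFree G U) {k : ℕ} (hk : 1 ≤ ε * k) (hr : 2 * (k ^ 3 + k ^ 2 + 1) + 7 ≤ r)
    {o : V} (ho : o ∈ U) :
    ∃ c : V → ℕ, 1 ≤ c o ∧ (∀ v ∈ U, G.Adj o v → 1 ≤ c v) ∧
      ∑ v ∈ U, (c v : ℝ) ≤ 2 * ∑ v ∈ U, (c v : ℝ) * x v + 1 := by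
  have hkr : 2 * k + 1 ≤ r := by
    have : k ≤ k ^ 2 := Nat.le_self_pow two_ne_zero k
    omega
  have hC4 : ∀ a ∈ U, ∀ b ∈ U, ∀ c ∈ U, ∀ d ∈ U, ¬ IsC4 G a b c d :=
    fun a ha b hb c hc d hd => not_isC4 hx hε hsmall (by omega) ha hb hc hd
  set A := U.filter (G.Adj o) with hA
  have hAU : A ⊆ U := Finset.filter_subset _ _
  have hoA : ∀ v ∈ A, G.Adj o v := fun v hv => (Finset.mem_filter.1 hv).2
  have hcard : A.card ≤ k ^ 3 + k ^ 2 := card_neighbors_le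
    (fun K hKA hK => not_clique hx hε hsmall htwin hk hkr (hKA.trans hAU) hK)
    (fun I hIA hI => not_star hx hε hsmall hk hkr ho (hIA.trans hAU) (fun v hv => hoA v (hIA hv))
      hI)
    (fun a ha b hb c hc d hd => hC4 a (hAU ha) b (hAU hb) c (hAU hc) d (hAU hd))
  set F := insert o A with hF
  have hFU : F ⊆ U := Finset.insert_subset ho hAU
  have hFcard : F.card ≤ k ^ 3 + k ^ 2 + 1 :=
    (Finset.card_insert_le _ _).trans (Nat.succ_le_succ hcard)
  obtain ⟨R, hRF, hoR, hinj, hsurj⟩ :=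
    exists_transversal (closedNbhd G F) (Finset.mem_insert_self o A)
  have hRA : R.erase o ⊆ A := fun v hv => (Finset.mem_insert.1
    (hRF (Finset.mem_of_mem_erase hv))).resolve_left (Finset.ne_of_mem_erase hv)
  have hRU := hRF.trans hFU
  obtain ⟨Q, hQR, hQ, hfree⟩ := exists_hitting_clique (G := G) (A := A)
    (fun a ha b hb c hc d hd => hC4 a (hAU ha) b (hAU hb) c (hAU hc) d (hAU hd))
    (fun a ha b hb c hc d hd e he => not_isC5 hx hε hsmall (by omega) ho (hAU ha) (hAU hb)
      (hAU hc) (hAU hd) (hAU he) (hoA a ha) (hoA b hb) (hoA c hc) (hoA d hd) (hoA e he))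
    (fun a₁ ha₁ a₂ ha₂ a₃ ha₃ b₁ hb₁ b₂ hb₂ b₃ hb₃ => not_isP3Pair hx hε hsmall (by omega) ho
      (hAU ha₁) (hAU ha₂) (hAU ha₃) (hAU hb₁) (hAU hb₂) (hAU hb₃) (hoA a₁ ha₁) (hoA a₂ ha₂)
      (hoA a₃ ha₃) (hoA b₁ hb₁) (hoA b₂ hb₂) (hoA b₃ hb₃))
  obtain ⟨cR, hcR, hhalf⟩ := exists_weights_of_universal (G := G) (R := R)
    (Q₀ := Q ∩ R.erase o) hoR
    (fun v hv hvo => hoA v (hRA (Finset.mem_erase.2 ⟨hvo, hv⟩)))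
    (twinFree_transversal hRF hinj hsurj)
    (fun a ha b hb c hc d hd => hC4 a (hRU ha) b (hRU hb) c (hRU hc) d (hRU hd))
    Finset.inter_subset_right (hQ.subset (by exact_mod_cast Finset.inter_subset_left))
    (hfree.mono fun v hv => by
      obtain ⟨hv, hvQ⟩ := Finset.mem_sdiff.1 hv
      exact Finset.mem_sdiff.2 ⟨hRA hv, fun h => hvQ (Finset.mem_inter.2 ⟨h, hv⟩)⟩)
  obtain ⟨c, hcF, hccard, hcS⟩ := exists_weights_blowup hFU htwin hRF hinj hsurj hcR hhalf
  refine ⟨c, hcF o (Finset.mem_insert_self _ _), fun v hv hov => hcF v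
    (Finset.mem_insert_of_mem (Finset.mem_filter.2 ⟨hv, hov⟩)), ?_⟩
  -- The support has at most `2 * |F| ≤ 2 * (k ^ 3 + k ^ 2 + 1)` vertices, which is why `r` must be
  -- of this size.
  have h := hx (U.filter (c · ≠ 0)) (by omega) (fun v => (c v : ℝ)) ((∑ v ∈ U, (c v : ℝ) + 1) / 2)
    fun S hS hP => by
      have := hcS S (hS.trans (Finset.filter_subset _ _)) hP
      have : (2 : ℝ) * ∑ v ∈ S, (c v : ℝ) ≤ ∑ v ∈ U, (c v : ℝ) + 1 := by exact_mod_cast this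
      linarith
  have h2 : ∑ v ∈ U with c v ≠ 0, (c v : ℝ) * (1 - x v) = ∑ v ∈ U, (c v : ℝ) * (1 - x v) := by
    refine Finset.sum_subset (Finset.filter_subset _ _) fun v hv hv' => ?_
    have : c v = 0 := by
      by_contra h0
      exact hv' (Finset.mem_filter.2 ⟨hv, h0⟩)
    rw [this, Nat.cast_zero, zero_mul]
  rw [h2] at h
  simp only [mul_sub, mul_one, Finset.sum_sub_distrib] at h
  linarith

end Blowup

/-! ### The local ratio rounding. -/

section Rounding
open scoped Classical

theorem exists_minimal_hitting {V : Type*} (G : SimpleGraph V) {U X : Finset V}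
    (hX : P3Free G (U \ X)) :
    ∃ Y ⊆ X, P3Free G (U \ Y) ∧ ∀ v ∈ Y, ¬ P3Free G (U \ Y.erase v) := by
  obtain ⟨Y, hY, hmin⟩ := Finset.exists_min_image
    (X.powerset.filter fun Y : Finset V => P3Free G (U \ Y)) Finset.card ⟨X, by simp [hX]⟩
  simp only [Finset.mem_filter, Finset.mem_powerset] at hY hmin
  refine ⟨Y, hY.1, hY.2, fun v hv hP => ?_⟩
  have := hmin (Y.erase v) ⟨(Finset.erase_subset _ _).trans hY.1, hP⟩
  have := Finset.card_erase_lt_of_mem hv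
  omega

/-- If `Y` contained the closed neighborhood of `o`, then `o` would be isolated after its return,
hence redundant in `Y`. -/
theorem exists_not_mem_of_minimal {V : Type*} {G : SimpleGraph V} {U Y : Finset V} {o : V}
    (ho : o ∈ U) (hY : P3Free G (U \ Y)) (hmin : ∀ v ∈ Y, ¬ P3Free G (U \ Y.erase v)) :
    ∃ v ∈ U, (v = o ∨ G.Adj o v) ∧ v ∉ Y := by
  by_contra hno
  push Not at hno
  refine hmin o (hno o ho (Or.inl rfl)) ?_
  have hiso : ∀ z ∈ U \ Y.erase o, ¬ G.Adj o z := fun z hz hoz => by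
    obtain ⟨hzU, hzY⟩ := Finset.mem_sdiff.1 hz
    exact hzY (Finset.mem_erase.2 ⟨hoz.ne', hno z hzU (Or.inr hoz)⟩)
  have hmem : ∀ z ∈ U \ Y.erase o, z ≠ o → z ∈ U \ Y := fun z hz hzo => by
    obtain ⟨hzU, hzY⟩ := Finset.mem_sdiff.1 hz
    exact Finset.mem_sdiff.2 ⟨hzU, fun h => hzY (Finset.mem_erase.2 ⟨hzo, h⟩)⟩
  intro u hu v hv w hw huv hvw huw
  refine hY u (hmem u hu ?_) v (hmem v hv ?_) w (hmem w hw ?_) huv hvw huw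
  · rintro rfl
    exact hiso v hv huv
  · rintro rfl
    exact hiso w hw hvw
  · rintro rfl
    exact hiso v hv hvw.symm

/-- Replacing `v` by its twin `u` maps an induced path avoiding `X` to one avoiding both `X` and
`v`; the only vertices that can be identified are `u` and `v`, which are adjacent. -/
theorem p3Free_sdiff_of_twin {V : Type*} {G : SimpleGraph V} {U X : Finset V} {u v : V}
    (hu : u ∈ U) (huv : G.Adj u v)
    (htwin : ∀ z ∈ U, z ≠ u → z ≠ v → (G.Adj z u ↔ G.Adj z v)) (huX : u ∉ X)
    (hX : P3Free G (U.erase v \ X)) : P3Free G (U \ X) := by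
  set f : V → V := fun z => if z = v then u else z with hf
  have hfmem : ∀ z ∈ U \ X, f z ∈ U.erase v \ X := by
    intro z hz
    obtain ⟨hzU, hzX⟩ := Finset.mem_sdiff.1 hz
    simp only [hf]
    split_ifs with h
    · exact Finset.mem_sdiff.2 ⟨Finset.mem_erase.2 ⟨huv.ne, hu⟩, huX⟩
    · exact Finset.mem_sdiff.2 ⟨Finset.mem_erase.2 ⟨h, hzU⟩, hzX⟩
  have hfadj : ∀ y ∈ U, ∀ z ∈ U, f y ≠ f z → (G.Adj y z ↔ G.Adj (f y) (f z)) := by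
    intro y hy z hz hne
    by_cases hyv : y = v <;> by_cases hzv : z = v
    · exact absurd (by rw [hyv, hzv]) hne
    · simp only [hf, hyv, hzv, if_true, if_false] at hne ⊢
      rw [G.adj_comm v z, G.adj_comm u z]
      exact (htwin z hz hne.symm hzv).symm
    · simp only [hf, hyv, hzv, if_true, if_false] at hne ⊢
      exact (htwin y hy hne hyv).symm
    · simp only [hf, hyv, hzv, if_false]
  have hfeq : ∀ y ∈ U, ∀ z ∈ U, f y = f z → y ≠ z → G.Adj y z := by
    intro y hy z hz he hne
    by_cases hyv : y = v <;> by_cases hzv : z = v <;> simp only [hf, hyv, hzv, if_true, if_false]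
      at he
    · exact absurd (hyv.trans hzv.symm) hne
    · rw [hyv, ← he]; exact huv.symm
    · rw [hzv, he]; exact huv
    · exact absurd he hne
  have hU : ∀ z ∈ U \ X, z ∈ U := fun z hz => (Finset.mem_sdiff.1 hz).1
  intro a ha b hb c hc hab hbc hac
  by_cases h1 : f a = f c
  · exact hfeq a (hU a ha) c (hU c hc) h1 hac
  refine (hfadj a (hU a ha) c (hU c hc) h1).2 ?_
  by_cases h2 : f a = f b
  · rw [h2]
    exact (hfadj b (hU b hb) c (hU c hc) (h2 ▸ h1)).1 hbc
  by_cases h3 : f b = f c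
  · rw [← h3]
    exact (hfadj a (hU a ha) b (hU b hb) h2).1 hab
  exact hX _ (hfmem a ha) _ (hfmem b hb) _ (hfmem c hc) ((hfadj a (hU a ha) b (hU b hb) h2).1 hab)
    ((hfadj b (hU b hb) c (hU c hc) h3).1 hbc) h1

theorem exists_hitting_le {V : Type*} {G : SimpleGraph V} {r : ℕ} {x : V → ℝ} {ε : ℝ}
    (hx : LocallyFeasible G r x) (hε : 0 < ε) {k : ℕ} (hk : 1 ≤ ε * k)
    (hr : 2 * (k ^ 3 + k ^ 2 + 1) + 7 ≤ r) (U : Finset V) :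
    ∀ c : V → ℝ, (∀ v ∈ U, 0 ≤ c v) →
      ∃ X ⊆ U, P3Free G (U \ X) ∧ ∑ v ∈ X, c v ≤ (2 + ε) * ∑ v ∈ U, c v * x v := by
  have hx0 : ∀ v, 0 ≤ x v := by
    intro v
    have := hx {v} (by rw [Finset.card_singleton]; omega) (fun _ => 1) 1 fun S hS _ => by
      have := Finset.card_le_card hS
      simpa using this
    simpa using this
  induction U using Finset.strongInduction with
  | H U ih =>
  have herase : ∀ v ∈ U, ∀ X, P3Free G (U.erase v \ X) → P3Free G (U \ insert v X) := by
    intro v hv X hX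
    refine hX.mono fun z hz => ?_
    obtain ⟨hzU, hzX⟩ := Finset.mem_sdiff.1 hz
    rw [Finset.mem_insert, not_or] at hzX
    exact Finset.mem_sdiff.2 ⟨Finset.mem_erase.2 ⟨hzX.1, hzU⟩, hzX.2⟩
  intro c hc
  rcases U.eq_empty_or_nonempty with rfl | ⟨o, ho⟩
  · exact ⟨∅, subset_rfl, by intro u hu; simp at hu, by simp⟩
  by_cases hbig : ∃ v ∈ U, c v ≤ (2 + ε) * (c v * x v)
  · obtain ⟨v, hv, hcv⟩ := hbig
    obtain ⟨X, hXU, hX, hle⟩ := ih (U.erase v) (Finset.erase_ssubset hv) c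
      fun z hz => hc z (Finset.mem_of_mem_erase hz)
    refine ⟨insert v X, Finset.insert_subset hv (hXU.trans (Finset.erase_subset _ _)),
      herase v hv X hX, ?_⟩
    rw [Finset.sum_insert fun h => (Finset.mem_erase.1 (hXU h)).1 rfl,
      ← Finset.add_sum_erase U _ hv, mul_add]
    exact add_le_add hcv hle
  push Not at hbig
  have hsmall : ∀ v ∈ U, (2 + ε) * x v < 1 := by
    intro v hv
    by_contra h
    have h1 := hbig v hv
    have h2 := mul_le_mul_of_nonneg_left (not_lt.1 h) (hc v hv)
    linarith
  have hpos : ∀ v ∈ U, 0 < c v := by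
    intro v hv
    refine lt_of_le_of_ne (hc v hv) fun h => ?_
    have := hbig v hv
    rw [← h] at this
    simp at this
  by_cases htwin : TwinFree G U
  · obtain ⟨d, hdo, hdn, hd⟩ := exists_local_ratio_weights hx hε hsmall htwin hk hr ho
    obtain ⟨v, hv, hmin⟩ := Finset.exists_min_image (U.filter (d · ≠ 0)) (fun v => c v / d v)
      ⟨o, Finset.mem_filter.2 ⟨ho, by omega⟩⟩
    obtain ⟨hvU, hdv⟩ := Finset.mem_filter.1 hv
    -- The largest multiple of `d` that keeps the reduced costs nonnegative; it makes `v` free.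
    set t := c v / d v with ht
    have hdv' : (0 : ℝ) < d v := Nat.cast_pos.2 (Nat.pos_of_ne_zero hdv)
    have ht0 : 0 ≤ t := div_nonneg (hc v hvU) hdv'.le
    have hc' : ∀ z ∈ U, 0 ≤ c z - t * d z := by
      intro z hz
      by_cases hdz : d z = 0
      · simp [hdz, hc z hz]
      · have := hmin z (Finset.mem_filter.2 ⟨hz, hdz⟩)
        rw [le_div_iff₀ (Nat.cast_pos.2 (Nat.pos_of_ne_zero hdz))] at this
        linarith
    have hcv : c v - t * d v = 0 := by
      rw [ht, div_mul_cancel₀ _ hdv'.ne', sub_self]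
    obtain ⟨X, hXU, hX, hle⟩ := ih (U.erase v) (Finset.erase_ssubset hvU) (fun z => c z - t * d z)
      fun z hz => hc' z (Finset.mem_of_mem_erase hz)
    have hXU' := hXU.trans (Finset.erase_subset _ _)
    obtain ⟨Y, hYX, hY, hYmin⟩ := exists_minimal_hitting G (herase v hvU X hX)
    have hYU : Y ⊆ U := hYX.trans (Finset.insert_subset hvU hXU')
    obtain ⟨z, hzU, hzo, hzY⟩ := exists_not_mem_of_minimal ho hY hYmin
    refine ⟨Y, hYU, hY, ?_⟩
    have h1 : ∑ y ∈ Y, (c y - t * d y) ≤ ∑ y ∈ X, (c y - t * d y) := by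
      have := Finset.sum_le_sum_of_subset_of_nonneg hYX (f := fun y => c y - t * d y)
        fun y hy _ => hc' y (Finset.insert_subset hvU hXU' hy)
      rwa [Finset.sum_insert fun h => (Finset.mem_erase.1 (hXU h)).1 rfl, hcv, zero_add] at this
    have h2 : ∑ y ∈ U.erase v, (c y - t * d y) * x y = ∑ y ∈ U, (c y - t * d y) * x y := by
      rw [← Finset.add_sum_erase U _ hvU, hcv, zero_mul, zero_add]
    have h3 : ∑ y ∈ Y, (d y : ℝ) + 1 ≤ ∑ y ∈ U, (d y : ℝ) := by
      have hdz : 1 ≤ d z := by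
        rcases hzo with rfl | h
        · exact hdo
        · exact hdn z hzU h
      have h4 := Finset.sum_le_sum_of_subset (f := d) (Finset.insert_subset hzU hYU)
      rw [Finset.sum_insert hzY] at h4
      have : ∑ y ∈ Y, d y + 1 ≤ ∑ y ∈ U, d y := by omega
      exact_mod_cast this
    have h4 : 0 ≤ ∑ y ∈ U, (d y : ℝ) * x y :=
      Finset.sum_nonneg fun y _ => mul_nonneg (Nat.cast_nonneg _) (hx0 y)
    have h5 : ∑ y ∈ Y, (d y : ℝ) ≤ (2 + ε) * ∑ y ∈ U, (d y : ℝ) * x y := by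
      nlinarith
    have h6 := mul_le_mul_of_nonneg_left h5 ht0
    have h7 := h1.trans hle
    rw [h2] at h7
    simp only [sub_mul, Finset.sum_sub_distrib, mul_assoc, ← Finset.mul_sum] at h7
    linarith
  · have : ∃ u ∈ U, ∃ v ∈ U, G.Adj u v ∧ x u ≤ x v ∧
        ∀ z ∈ U, z ≠ u → z ≠ v → (G.Adj z u ↔ G.Adj z v) := by
      simp only [TwinFree, not_forall, not_exists, not_and] at htwin
      obtain ⟨u, hu, v, hv, huv, hno⟩ := htwin
      have hiff : ∀ z ∈ U, z ≠ u → z ≠ v → (G.Adj z u ↔ G.Adj z v) := by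
        intro z hz hzu hzv
        have hs := hno z hz hzu hzv
        by_contra hne
        refine hs ?_
        by_cases h : G.Adj z u
        · exact ⟨⟨u, by simp, h⟩, v, by simp, by tauto⟩
        · exact ⟨⟨v, by simp, by tauto⟩, u, by simp, h⟩
      rcases le_total (x u) (x v) with h | h
      · exact ⟨u, hu, v, hv, huv, h, hiff⟩
      · exact ⟨v, hv, u, hu, huv.symm, h, fun z hz h1 h2 => (hiff z hz h2 h1).symm⟩
    obtain ⟨u, hu, v, hv, huv, hxuv, hiff⟩ := this
    have huE : u ∈ U.erase v := Finset.mem_erase.2 ⟨huv.ne, hu⟩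
    -- Moving the cost of `v` to `u` does not increase the LP value, as `x u ≤ x v`. The twins are
    -- then taken together or `v` is kept along with `u`.
    obtain ⟨X, hXU, hX, hle⟩ := ih (U.erase v) (Finset.erase_ssubset hv)
      (fun z => c z + if z = u then c v else 0) fun z hz => by
        have h1 := hc z (Finset.mem_of_mem_erase hz)
        have h2 := hc v hv
        split_ifs <;> linarith
    have hXU' := hXU.trans (Finset.erase_subset _ _)
    have hvX : v ∉ X := fun h => (Finset.mem_erase.1 (hXU h)).1 rfl
    have hbound : ∑ z ∈ U.erase v, (c z + if z = u then c v else 0) * x z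
        ≤ ∑ z ∈ U, c z * x z := by
      simp only [add_mul, ite_mul, zero_mul, Finset.sum_add_distrib]
      rw [Finset.sum_ite_eq', if_pos huE, ← Finset.add_sum_erase U _ hv, add_comm]
      exact add_le_add (mul_le_mul_of_nonneg_left hxuv (hc v hv)) le_rfl
    have hle' := hle.trans (mul_le_mul_of_nonneg_left hbound (by linarith))
    rw [Finset.sum_add_distrib, Finset.sum_ite_eq'] at hle'
    by_cases huX : u ∈ X
    · refine ⟨insert v X, Finset.insert_subset hv hXU', herase v hv X hX, ?_⟩
      rw [if_pos huX] at hle'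
      rw [Finset.sum_insert hvX]
      linarith
    · refine ⟨X, hXU', p3Free_sdiff_of_twin hu huv hiff huX hX, ?_⟩
      rw [if_neg huX] at hle'
      linarith

end Rounding

theorem clusterOPT_le_mul_sum {V : Type*} [Fintype V] {G : SimpleGraph V} {r : ℕ} {ε : ℝ}
    (hε : 0 < ε) {k : ℕ} (hk : 1 ≤ ε * k) (hr : 2 * (k ^ 3 + k ^ 2 + 1) + 7 ≤ r) {c : V → ℝ}
    (hc : ∀ v, 0 ≤ c v) {x : V → ℝ} (hx : x ∈ clusterSA r G) :
    clusterOPT G c ≤ (2 + ε) * ∑ v, c v * x v := by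
  classical
  obtain ⟨X, -, hX, hle⟩ := exists_hitting_le (locallyFeasible_of_mem_clusterSA hx) hε hk hr
    Finset.univ c fun v _ => hc v
  have hbdd : BddBelow {t : ℝ | ∃ X : Finset V, IsHittingSet G X ∧ t = setCost c X} := by
    refine ⟨0, ?_⟩
    rintro _ ⟨Y, -, rfl⟩
    exact Finset.sum_nonneg fun v _ => hc v
  exact (csInf_le hbdd ⟨X, (isHittingSet_iff G X).2 hX, rfl⟩).trans hle

theorem clusterSA_nonempty {V : Type*} [Fintype V] (G : SimpleGraph V) (r : ℕ) :
    (clusterSA r G).Nonempty := by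
  classical
  refine ⟨_, indicator_mem_clusterSA r (X := Finset.univ) ((isHittingSet_iff G _).2 ?_)⟩
  intro u hu
  simp at hu

theorem mainTheorem3 :
    ∃ p : Polynomial ℝ, ∀ ε : ℝ, 0 < ε → ∃ r : ℕ, (r : ℝ) ≤ p.eval (1 / ε) ∧
      ∀ (V : Type*) [Fintype V] (G : SimpleGraph V),
        (∀ X : Finset V, IsHittingSet G X → (X : Set V).indicator 1 ∈ clusterSA r G) ∧
        ∀ c : V → ℝ, (∀ v, 0 ≤ c v) →
          clusterOPT G c ≤ (2 + ε) * clusterSAValue r G c := by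
  -- The required number of rounds for `k = ⌈1/ε⌉`, with `k` bounded by `1/ε + 1`.
  refine ⟨2 * ((Polynomial.X + 1) ^ 3 + (Polynomial.X + 1) ^ 2 + 1) + 7, fun ε hε => ?_⟩
  set k := ⌈1 / ε⌉₊ with hkdef
  have hk : 1 ≤ ε * k := by
    have := Nat.le_ceil (1 / ε)
    rwa [div_le_iff₀ hε, mul_comm, ← hkdef] at this
  have hk' : (k : ℝ) ≤ 1 / ε + 1 := (Nat.ceil_lt_add_one (by positivity)).le
  refine ⟨2 * (k ^ 3 + k ^ 2 + 1) + 7, ?_, fun V _ G =>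
    ⟨fun X hX => indicator_mem_clusterSA _ hX, fun c hc => ?_⟩⟩
  · simp only [Polynomial.eval_add, Polynomial.eval_mul, Polynomial.eval_pow, Polynomial.eval_X,
      Polynomial.eval_one, Polynomial.eval_ofNat]
    push_cast
    gcongr
  · have h2 : (0 : ℝ) < 2 + ε := by linarith
    rw [← div_le_iff₀' h2]
    obtain ⟨x, hx⟩ := clusterSA_nonempty G (2 * (k ^ 3 + k ^ 2 + 1) + 7)
    refine le_csInf ⟨_, x, hx, rfl⟩ ?_
    rintro _ ⟨y, hy, rfl⟩
    rw [div_le_iff₀' h2]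
    exact clusterOPT_le_mul_sum hε hk le_rfl hc hy
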